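/- **Setting.** Let $m\ge 0$, $\mathcal E_a<\mathcal E_b$, $N\ge 1$, $\varepsilon>0$, $h=(\mathcal E_b-\mathcal E_a)/N$ and $\mathcal E_k=\mathcal E_a+(k-\tfrac12)h$ for $k=1,\dots,N$. Let $U_0,U_1\in C^\infty(\mathbb R^m;\mathbb R)$ satisfy $|\partial_i\partial_jU_0|,|\partial_i\partial_jU_1|\le C_E$ on $\mathbb R^m$ for all $i,j$. Let $V(\mathcal E,x)\in\mathbb C$ be Borel measurable in $x\in\mathbb R^m$ for each $\mathcal E\in[\mathcal E_a,\mathcal E_b]$, and bounded: $|V|\le M_0$ on $[\mathcal E_a,\mathcal E_b]\times\mathbb R^m$. Write $\widetilde U_0=U_0$ and $\widetilde U_k=U_1+\mathcal E_k$ for $k\ge1$. Fix $a_1,\dots,a_m>0$, $\tilde q,\tilde p\in\mathbb R^m$, and $$u_{\rm in}(x)=\Big(\prod_{j=1}^m a_j\Big)^{1/4}(\pi\varepsilon)^{-m/4}\exp\Big(\tfrac{\mathrm i}{\varepsilon}\tilde p\cdot(x-\tilde q)-\sum_{j=1}^m\tfrac{a_j}{2\varepsilon}(x_j-\tilde q_j)^2\Big),$$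 $$A_0(q,p)=2^{m/2}\int_{\mathbb R^m}u_{\rm in}(y)\,e^{\frac{\mathrm i}{\varepsilon}\left(-p\cdot(y-q)+\frac{\mathrm i}{2}|y-q|^2\right)}\,\mathrm dy,\qquad \pi(z)=\frac{|A_0(z)|}{\int_{\mathbb R^{2m}}|A_0|}.$$ **The process.** $\tilde z_t=(z_t,l_t)\in\mathbb R^{2m}\times\{0,\dots,N\}$ is the surface hopping process: $z_0$ has density $\pi$ and $l_0=0$; while $l_t=l$, the point $z_t=(q_t,p_t)$ solves $\dot q=p$, $\dot p=-\nabla\widetilde U_l(q)$; and $l_t$ jumps from $l$ to $l'\ne l$ at rate $\lambda_{ll'}(q_t)$, where $\lambda_{0k}=h|V(\mathcal E_k,\cdot)|$ and $\lambda_{k0}=|V(\mathcal E_k,\cdot)|$ for $k=1,\dots,N$, and all other rates are $0$. Let $0<t_1<\dots<t_\nu\le t$ be the jump times up to time $t$, and $l_0=0,l_1,\dots,l_\nu$ the successive surfaces. **The wave packet.** With the jump times and surfaces held fixed, let $(Q,P)(s,z_0)$ be the continuous solution from $z_0$ of the above Hamiltonian equations along the path of surfaces $l_s$, and let $S(0)=0$,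 $A(0)=A_0(z_0)$, with $S,A$ continuous and, between the jump times, $$\dot S=\tfrac12|P|^2-\widetilde U_{l_s}(Q),\qquad \dot A=\tfrac12A\,\mathrm{tr}\Big(Z^{-1}\big(\partial_zP-\mathrm i\,\partial_zQ\,\nabla^2\widetilde U_{l_s}(Q)\big)\Big),$$ where $\partial_z=\partial_q-\mathrm i\,\partial_p$ (derivatives in $z_0=(q,p)$, with $(\partial_zF)_{jk}=\partial_{z_j}F_k$) and $Z=\partial_z(Q+\mathrm iP)$. Put $\Theta(t,x)=S+P\cdot(x-Q)+\tfrac{\mathrm i}2|x-Q|^2$ and $$\Gamma(t)=\exp\Big(\int_0^t\sum_{l'\ne l_s}\lambda_{l_sl'}(Q(s))\,\mathrm ds\Big)\prod_{j=1}^{\nu}\frac{\tau_j}{|\tau_j|},$$ where $\tau_j=-\mathrm i\,\overline{V(\mathcal E_k,Q(t_j))}$ if the $j$-th jump is from $0$ to $k$, and $\tau_j=-\mathrm i\,V(\mathcal E_k,Q(t_j))$ if it is from $k$ to $0$. The weighted wave packet is $$W(t,x;\tilde z_t)=\frac1{(2\pi\varepsilon)^{3m/2}}\,\frac1{\pi(z_0)}\,A(t)\,e^{\frac{\mathrm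 i}{\varepsilon}\Theta(t,x)}\,\Gamma(t),\qquad f(\tilde z_t)=\|W(t,\cdot\,;\tilde z_t)\|^2_{L^2(\mathbb R^m)}.$$ **Theorem.** There is a function $K(t)$, depending only on $m,C_E,M_0,\mathcal E_a,\mathcal E_b$ (in particular not on $\varepsilon$, $N$, $a$, $\tilde q$, $\tilde p$), such that for all $t\ge0$ and all data as above $$\mathbb E\big[f(\tilde z_t)\big]\le K(t)^2\prod_{j=1}^m\frac{1+a_j}{\sqrt{a_j}}.$$ -/

import Mathlib

namespace FrozenGaussian

open MeasureTheory ProbabilityTheory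

noncomputable section

/-- The nuclear configuration space `ℝᵐ`. -/
abbrev Space (m : ℕ) : Type := EuclideanSpace ℝ (Fin m)

/-- The phase space `ℝ²ᵐ`, with points `z = (q, p)`. -/
abbrev Phase (m : ℕ) : Type := Space m × Space m

/-- The energy surfaces: `none` is the molecule orbital (surface `0`), `some k` is the metal
orbital number `k + 1`, for `k = 0, …, N - 1`. -/
abbrev Surface (N : ℕ) : Type := Option (Fin N)

/-- The data of the Anderson-Holstein system with `N` metal orbitals in dimension `m`,
together with the parameters `a`, `qIn`, `pIn` of the Gaussian initial wave packet. -/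
structure Model (m N : ℕ) where
  /-- the semiclassical parameter -/
  eps : ℝ
  /-- the lower end of the metal band -/
  bandMin : ℝ
  /-- the upper end of the metal band -/
  bandMax : ℝ
  /-- the nuclear potential of the charged molecule -/
  U0 : Space m → ℝ
  /-- the nuclear potential of the neutral molecule -/
  U1 : Space m → ℝ
  /-- the molecule-metal coupling `V(energy, x)` -/
  V : ℝ → Space m → ℂ
  /-- the inverse squared widths of the initial packet -/
  a : Fin m → ℝ
  /-- the centre of the initial packet -/
  qIn : Space m
  /-- the momentum of the initial packet -/
  pIn : Space m

/-- The second partial derivative `∂ᵢ∂ⱼ U (x)`. -/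
def secondPartial {m : ℕ} (U : Space m → ℝ) (x : Space m) (i j : Fin m) : ℝ :=
  iteratedFDeriv ℝ 2 U x ![EuclideanSpace.single i 1, EuclideanSpace.single j 1]

/-- `U` is smooth and all its second partial derivatives are bounded by `C` on `ℝᵐ`. -/
def Subquadratic {m : ℕ} (C : ℝ) (U : Space m → ℝ) : Prop :=
  ContDiff ℝ ((⊤ : ℕ∞) : WithTop ℕ∞) U ∧ ∀ x i j, |secondPartial U x i j| ≤ C

/-- The matrix `∂_z F` with entries `(∂_{q_j} - i ∂_{p_j}) F_k` (row `j`, column `k`). -/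
def dz {m : ℕ} (F : Phase m → Space m) (z : Phase m) : Matrix (Fin m) (Fin m) ℂ :=
  Matrix.of fun j k =>
    ((fderiv ℝ F z (EuclideanSpace.single j 1, 0) k : ℝ) : ℂ)
      - Complex.I * ((fderiv ℝ F z (0, EuclideanSpace.single j 1) k : ℝ) : ℂ)

/-- A hopping history: `hops` is the number of hops, `time j` is the time of the `j`-th hop
(`1 ≤ j ≤ hops`), `surface 0` is the initial surface and `surface j` the one reached by the
`j`-th hop. The values of `time` and `surface` at other indices play no role. -/
structure History (N : ℕ) where
  hops : ℕ
  time : ℕ → ℝ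
  surface : ℕ → Surface N

/-- The surface occupied at time `s`: a right-continuous step function. -/
def History.surfaceAt {N : ℕ} (H : History N) (s : ℝ) : Surface N :=
  H.surface ((Finset.Icc 1 H.hops).filter fun j => H.time j ≤ s).card

namespace Model

variable {m N : ℕ} (D : Model m N)

/-! ### Surfaces, couplings and rates -/

/-- The spacing `h` of the discretized band. -/
def spacing : ℝ := (D.bandMax - D.bandMin) / N

/-- The midpoint energies of the `N` cells of the band. -/
def energy (k : Fin N) : ℝ := D.bandMin + ((k : ℝ) + 1 / 2) * D.spacing

/-- The potential of each surface. -/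
def potential : Surface N → Space m → ℝ
  | none => D.U0
  | some k => fun x => D.U1 x + D.energy k

/-- The hopping coefficient `τ` for a hop from one surface to another at position `q`. -/
def hopCoeff : Surface N → Surface N → Space m → ℂ
  | none, some k, q => -Complex.I * (starRingEnd ℂ) (D.V (D.energy k) q)
  | some k, none, q => -Complex.I * D.V (D.energy k) q
  | _, _, _ => 0

/-- The off-diagonal entries `λ_{l l'}(q)` of the generator of the hopping process. -/
def hopRate : Surface N → Surface N → Space m → ℝ
  | none, some k, q => D.spacing * ‖D.V (D.energy k) q‖
  | some k, none, q => ‖D.V (D.energy k) q‖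
  | _, _, _ => 0

/-- The total rate at which a packet at position `q` leaves the surface `l`. -/
def exitRate (l : Surface N) (q : Space m) : ℝ := ∑ l' : Surface N, D.hopRate l l' q

/-! ### Classical dynamics along a surface path -/

/-- The Hamiltonian vector field `(p, -∇U(q))` of the surface `l`. -/
def field (l : Surface N) (z : Phase m) : Phase m :=
  (z.2, -gradient (D.potential l) z.1)

/-- `z` is the continuous solution of Hamilton's equations `z' = field (ℓ s) z` with `z 0 = z₀`
along the right-continuous surface path `ℓ`. Derivatives are right derivatives, so that the
equation makes sense at the hopping times too. -/
def IsPath (ℓ : ℝ → Surface N) (z₀ : Phase m) (z : ℝ → Phase m) : Prop :=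
  z 0 = z₀ ∧ ContinuousOn z (Set.Ici 0) ∧
    ∀ s, 0 ≤ s → HasDerivWithinAt z (D.field (ℓ s) (z s)) (Set.Ici s) s

open Classical in
/-- The map taking `z₀` to the position at time `s` of the solution that starts at `z₀`. -/
def flow (ℓ : ℝ → Surface N) (s : ℝ) (z₀ : Phase m) : Phase m :=
  if h : ∃ z, D.IsPath ℓ z₀ z then h.choose s else z₀

/-- The position `Q`. -/
def Q (ℓ : ℝ → Surface N) (s : ℝ) (z₀ : Phase m) : Space m := (D.flow ℓ s z₀).1

/-- The momentum `P`. -/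
def P (ℓ : ℝ → Surface N) (s : ℝ) (z₀ : Phase m) : Space m := (D.flow ℓ s z₀).2

/-- The action `S`, with `S 0 = 0` and `S' = |P|² / 2 - U(Q)`. -/
def action (ℓ : ℝ → Surface N) (t : ℝ) (z₀ : Phase m) : ℝ :=
  ∫ s in (0 : ℝ)..t, (‖D.P ℓ s z₀‖ ^ 2 / 2 - D.potential (ℓ s) (D.Q ℓ s z₀))

/-- The matrix `Z = ∂_z (Q + i P)`. -/
def Z (ℓ : ℝ → Surface N) (s : ℝ) (z₀ : Phase m) : Matrix (Fin m) (Fin m) ℂ :=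
  dz (D.Q ℓ s) z₀ + Complex.I • dz (D.P ℓ s) z₀

/-- The Hessian matrix of the potential of the current surface at `Q`. -/
def hessian (ℓ : ℝ → Surface N) (s : ℝ) (z₀ : Phase m) : Matrix (Fin m) (Fin m) ℂ :=
  Matrix.of fun i j => ((secondPartial (D.potential (ℓ s)) (D.Q ℓ s z₀) i j : ℝ) : ℂ)

/-- The coefficient of the linear equation for the amplitude,
`tr (Z⁻¹ (∂_z P - i ∂_z Q ∇²U(Q))) / 2`. -/
def amplitudeRate (ℓ : ℝ → Surface N) (s : ℝ) (z₀ : Phase m) : ℂ :=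
  (1 / 2) * Matrix.trace ((D.Z ℓ s z₀)⁻¹ *
    (dz (D.P ℓ s) z₀ - Complex.I • (dz (D.Q ℓ s) z₀ * D.hessian ℓ s z₀)))

/-! ### The initial packet and the sampling density -/

/-- The Gaussian initial wave function on the molecule orbital. -/
def uIn (x : Space m) : ℂ :=
  (((∏ j, D.a j) ^ (1 / 4 : ℝ) * (Real.pi * D.eps) ^ (-(m : ℝ) / 4) : ℝ) : ℂ)
    * Complex.exp (Complex.I / D.eps * (inner ℝ D.pIn (x - D.qIn) : ℝ))
    * Complex.exp ((-∑ j, D.a j / (2 * D.eps) * (x j - D.qIn j) ^ 2 : ℝ) : ℂ)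

/-- The initial amplitude `A₀(0, q, p)`. -/
def A0 (z : Phase m) : ℂ :=
  (((2 : ℝ) ^ ((m : ℝ) / 2) : ℝ) : ℂ) * ∫ y : Space m, D.uIn y *
    Complex.exp (Complex.I / D.eps *
      (-((inner ℝ z.2 (y - z.1) : ℝ) : ℂ) + Complex.I / 2 * ((‖y - z.1‖ ^ 2 : ℝ) : ℂ)))

/-- The density of the initial sampling, `π(z) = |A₀(0, z)| / ∫ |A₀(0, ·)|`. -/
def samplingDensity (z : Phase m) : ℝ := ‖D.A0 z‖ / ∫ w : Phase m, ‖D.A0 w‖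

/-! ### Amplitude, phase, weight and wave packet along a history -/

/-- `A` is the continuous solution of the amplitude equation along the surface path `ℓ`. -/
def IsAmplitude (ℓ : ℝ → Surface N) (z₀ : Phase m) (A : ℝ → ℂ) : Prop :=
  A 0 = D.A0 z₀ ∧ ContinuousOn A (Set.Ici 0) ∧
    ∀ s, 0 ≤ s → HasDerivWithinAt A (D.amplitudeRate ℓ s z₀ * A s) (Set.Ici s) s

open Classical in
/-- The amplitude at time `t` of the packet that starts at `z₀`. -/
def amplitude (ℓ : ℝ → Surface N) (t : ℝ) (z₀ : Phase m) : ℂ :=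
  if h : ∃ A, D.IsAmplitude ℓ z₀ A then h.choose t else D.A0 z₀

/-- The complex phase `Θ = S + P · (x - Q) + i |x - Q|² / 2`. -/
def phase (ℓ : ℝ → Surface N) (t : ℝ) (z₀ : Phase m) (x : Space m) : ℂ :=
  ((D.action ℓ t z₀ : ℝ) : ℂ)
    + ((inner ℝ (D.P ℓ t z₀) (x - D.Q ℓ t z₀) : ℝ) : ℂ)
    + Complex.I / 2 * ((‖x - D.Q ℓ t z₀‖ ^ 2 : ℝ) : ℂ)

/-- The weight `Γ`: the exponential of the exit rate integrated along the path (that is, the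
product of the exponentials over the sojourns on the successive surfaces), times the factor
`τ / |τ|` of each hop. -/
def weight (H : History N) (t : ℝ) (z₀ : Phase m) : ℂ :=
  ((Real.exp (∫ s in (0 : ℝ)..t, D.exitRate (H.surfaceAt s) (D.Q H.surfaceAt s z₀)) : ℝ) : ℂ)
    * ∏ j ∈ Finset.range H.hops,
        D.hopCoeff (H.surface j) (H.surface (j + 1)) (D.Q H.surfaceAt (H.time (j + 1)) z₀) /
          ((‖D.hopCoeff (H.surface j) (H.surface (j + 1))
            (D.Q H.surfaceAt (H.time (j + 1)) z₀)‖ : ℝ) : ℂ)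

/-- The weighted wave packet `W(t, x)` of the history `H` started at `z₀`. -/
def wavePacket (H : History N) (t : ℝ) (z₀ : Phase m) (x : Space m) : ℂ :=
  ((1 / (2 * Real.pi * D.eps) ^ (3 * (m : ℝ) / 2) : ℝ) : ℂ)
    * ((1 / D.samplingDensity z₀ : ℝ) : ℂ)
    * D.amplitude H.surfaceAt t z₀
    * Complex.exp (Complex.I / D.eps * D.phase H.surfaceAt t z₀ x)
    * D.weight H t z₀

/-- The squared `L²` norm of the wave packet, with values in `[0, ∞]`. -/
def packetNormSq (H : History N) (t : ℝ) (z₀ : Phase m) : ENNReal :=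
  ∫⁻ x : Space m, ‖D.wavePacket H t z₀ x‖ₑ ^ 2

/-! ### The surface hopping process

The piecewise deterministic Markov process `(z_t, l_t)` starts on the molecule orbital at a point
`z₀` with density `π`. While `l_t = l`, the point moves along the Hamiltonian flow of the surface
`l`, and each surface `l'` is hopped onto at rate `λ_{l l'}(q_t)`. The process is realized from
`z₀` and independent standard exponential variables, a fresh one for every stage `n` and every
target `l'`: after `n` hops, the hop onto `l'` is due when the rate `λ_{l l'}` integrated since
the last hop reaches the variable attached to `(n, l')`, and the first hop that is due takes
place. -/

/-- The waiting time (possibly infinite) on the surface `l`, from the point `z`, until the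
integrated rate of hopping onto `l'` reaches the threshold `e`. -/
def waitingTime (l : Surface N) (z : Phase m) (l' : Surface N) (e : ℝ) : ENNReal :=
  ⨅ (r : NNReal) (_ : e ≤ ∫ s in (0 : ℝ)..r, D.hopRate l l' (D.Q (fun _ => l) s z)), (r : ENNReal)

/-- The time of a hop, the phase space point at that time, and the surface that is reached. -/
structure Stage (m N : ℕ) where
  time : ENNReal
  point : Phase m
  surface : Surface N

/-- A target with the shortest waiting time. -/
def firstTarget (w : Surface N → ENNReal) : Surface N := (Finite.exists_min w).choose

/-- The state of the process right after its `n`-th hop; the time is `∞` if there is no `n`-th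
hop. -/
def stage (z₀ : Phase m) (e : ℕ × Surface N → ℝ) : ℕ → Stage m N
  | 0 => ⟨0, z₀, none⟩
  | n + 1 =>
    let S := stage z₀ e n
    let w : Surface N → ENNReal := fun l' => D.waitingTime S.surface S.point l' (e (n, l'))
    ⟨S.time + w (firstTarget w),
      D.flow (fun _ => S.surface) (w (firstTarget w)).toReal S.point,
      firstTarget w⟩

/-- The history of the process up to time `t`; almost surely there are finitely many hops. -/
def history (z₀ : Phase m) (e : ℕ × Surface N → ℝ) (t : ℝ) : History N where
  hops := sSup {n : ℕ | (D.stage z₀ e n).time ≤ ENNReal.ofReal t}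
  time := fun n => (D.stage z₀ e n).time.toReal
  surface := fun n => (D.stage z₀ e n).surface

/-- The joint law of the initial point, which has density `π`, and of the independent standard
exponential variables. -/
def law : Measure (Phase m × (ℕ × Surface N → ℝ)) :=
  ((volume : Measure (Phase m)).withDensity fun z => ENNReal.ofReal (D.samplingDensity z)).prod
    (Measure.infinitePi fun _ : ℕ × Surface N => expMeasure 1)

/-- The expected squared `L²` norm of the weighted wave packet sampled at time `t`. -/
def expectedNormSq (t : ℝ) : ENNReal :=
  ∫⁻ ξ, D.packetNormSq (D.history ξ.1 ξ.2 t) t ξ.1 ∂D.law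

end Model

end

end FrozenGaussian

namespace FrozenGaussian

open MeasureTheory ProbabilityTheory Set Filter Topology
open scoped BoundedContinuousFunction

noncomputable section

/-! ### Global solutions of Lipschitz equations that are right-continuous in time -/

section ODE

variable {E : Type*} [NormedAddCommGroup E] [NormedSpace ℝ E]

/-! The randomness plays almost no role: `packetNormSq` has a bound that holds for every hopping
history and every starting point, and the law has mass at most one (`law_univ_le_one`).

The pointwise bound rests on `norm_amplitude_le` and `norm_weight_le`. The amplitude grows at rate
`tr (Z⁻¹ M) / 2`. The derivative of the flow is at most exponential in time, by Grönwall, which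
bounds `M`. It is also symplectic, because Hessians are symmetric, and this forces `|ξ Z|² ≥ 2
|ξ|²`, so `Z⁻¹` never blows up (`two_mul_sum_norm_sq_le`, `norm_trace_inv_mul_le`). Hence `|A(t)| ≤
|A₀(z₀)| e^{Rt}`, with `R` depending on `m`, `C` and `t` only. The hop factors of the weight have
modulus at most one, and the exit rates are bounded uniformly in `N` because the `N` rates out of
the molecule carry the factor `h`.

The sampling factor `1 / π(z₀) = ∫ |A₀| / |A₀(z₀)|` cancels `|A₀(z₀)|`. What remains is `(∫ |A₀|)²`
times the squared norm of a Gaussian of width `√ε` and the squared prefactor. All are explicit, the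
powers of `ε` cancel, and the product over `(1 + a) / √a` appears (`integral_norm_A0_sq`).

Flow derivatives are needed along paths where the vector field switches, so existence and
differentiability in the initial point are proved for right-continuous switching with right
derivatives. -/

theorem integral_exp_mul_le {c s : ℝ} (hc : 0 < c) :
    ∫ r in (0 : ℝ)..s, Real.exp (c * r) ≤ Real.exp (c * s) / c := by
  have h : ∫ r in (0 : ℝ)..s, Real.exp (c * r) = Real.exp (c * s) / c - 1 / c := by
    have := intervalIntegral.integral_eq_sub_of_hasDerivAt (a := 0) (b := s)
      (f := fun r => Real.exp (c * r) / c) (f' := fun r => Real.exp (c * r)) (fun r _ => by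
        have h1 : HasDerivAt (fun r : ℝ => c * r) c r := by
          simpa using (hasDerivAt_id r).const_mul c
        have h2 := h1.exp.div_const c
        rwa [mul_div_assoc, div_self hc.ne', mul_one] at h2)
      ((by fun_prop : Continuous fun r : ℝ => Real.exp (c * r)).intervalIntegrable _ _)
    simpa using this
  rw [h]
  have : 0 < 1 / c := by positivity
  linarith

/-- A vector field that is uniformly Lipschitz in space, bounded at the origin, and right-continuous
in time along continuous curves has a global forward solution from every point. -/
theorem exists_forward_solution [CompleteSpace E] {f : ℝ → E → E} {L M : ℝ} (hL : 0 < L)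
    (hlip : ∀ s x y, ‖f s x - f s y‖ ≤ L * ‖x - y‖) (hzero : ∀ s, ‖f s 0‖ ≤ M)
    (hmeas : ∀ z : ℝ → E, Continuous z → AEStronglyMeasurable (fun s => f s (z s)) volume)
    (hright : ∀ z : ℝ → E, Continuous z → ∀ s, ContinuousWithinAt (fun r => f r (z r)) (Ici s) s)
    (x₀ : E) :
    ∃ z : ℝ → E, z 0 = x₀ ∧ Continuous z ∧
      ∀ s, 0 ≤ s → HasDerivWithinAt z (f s (z s)) (Ici s) s := by
  have hM : 0 ≤ M := (norm_nonneg _).trans (hzero 0)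
  -- Picard iteration in a weighted norm: the unknown is `w s = exp (-c s) • z s`, and the rate `2
  -- L` makes the contraction constant `L / c = 1 / 2` on the whole half-line at once.
  set c : ℝ := 2 * L with hc
  have hc0 : 0 < c := by positivity
  have hcurve : ∀ w : ℝ →ᵇ E, Continuous fun r => Real.exp (c * r) • w r := fun w => by fun_prop
  have hbound : ∀ (w : ℝ →ᵇ E) r,
      ‖f r (Real.exp (c * r) • w r)‖ ≤ M + L * ‖w‖ * Real.exp (c * r) := fun w r => by
    have h1 := hlip r (Real.exp (c * r) • w r) 0
    have h2 : ‖Real.exp (c * r) • w r‖ ≤ Real.exp (c * r) * ‖w‖ := by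
      rw [norm_smul, Real.norm_of_nonneg (Real.exp_pos _).le]
      gcongr
      exact w.norm_coe_le_norm r
    rw [sub_zero] at h1
    calc ‖f r (Real.exp (c * r) • w r)‖
        = ‖f r 0 + (f r (Real.exp (c * r) • w r) - f r 0)‖ := by rw [add_sub_cancel]
      _ ≤ M + L * ‖Real.exp (c * r) • w r‖ := (norm_add_le _ _).trans (add_le_add (hzero r) h1)
      _ ≤ M + L * (Real.exp (c * r) * ‖w‖) := by gcongr
      _ = _ := by ring
  have hint : ∀ (w : ℝ →ᵇ E) a b,
      IntervalIntegrable (fun r => f r (Real.exp (c * r) • w r)) volume a b := fun w a b =>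
    ((by fun_prop : Continuous fun r : ℝ => M + L * ‖w‖ * Real.exp (c * r)).intervalIntegrable
      a b).mono_fun (hmeas _ (hcurve w)).restrict
      (Eventually.of_forall fun r => (hbound w r).trans (le_abs_self _))
  have hexp : ∀ s : ℝ, Real.exp (-(c * s)) * Real.exp (c * s) = 1 := fun s => by
    rw [← Real.exp_add]; simp
  -- `max s 0` freezes the curve at negative times, so that it is bounded and continuous on all of
  -- `ℝ`.
  let Φ : (ℝ →ᵇ E) → (ℝ →ᵇ E) := fun w =>
    BoundedContinuousFunction.ofNormedAddCommGroup
      (fun s => Real.exp (-(c * max s 0)) •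
        (x₀ + ∫ r in (0 : ℝ)..max s 0, f r (Real.exp (c * r) • w r)))
      (by
        have h1 := intervalIntegral.continuous_primitive (hint w) 0
        have h2 : Continuous fun s : ℝ => max s 0 := by fun_prop
        have h3 := h1.comp h2
        exact (by fun_prop : Continuous fun s : ℝ => Real.exp (-(c * max s 0))).smul
          (continuous_const.add h3))
      (‖x₀‖ + (M + L * ‖w‖) / c)
      (fun s => by
        set u := max s 0 with hu
        have hu0 : 0 ≤ u := le_max_right _ _
        have h1 : ‖∫ r in (0 : ℝ)..u, f r (Real.exp (c * r) • w r)‖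
            ≤ ∫ r in (0 : ℝ)..u, (M + L * ‖w‖) * Real.exp (c * r) := by
          apply intervalIntegral.norm_integral_le_of_norm_le hu0
          · refine Eventually.of_forall fun r hr => (hbound w r).trans ?_
            have : 1 ≤ Real.exp (c * r) := Real.one_le_exp (mul_nonneg hc0.le hr.1.le)
            nlinarith [norm_nonneg w]
          · exact (by fun_prop : Continuous fun r : ℝ =>
              (M + L * ‖w‖) * Real.exp (c * r)).intervalIntegrable _ _
        rw [intervalIntegral.integral_const_mul] at h1
        have h2 : 0 ≤ M + L * ‖w‖ := by positivity
        have h3 := h1.trans (mul_le_mul_of_nonneg_left (integral_exp_mul_le (s := u) hc0) h2)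
        rw [norm_smul, Real.norm_of_nonneg (Real.exp_pos _).le]
        have h4 : Real.exp (-(c * u)) ≤ 1 := Real.exp_le_one_iff.2 (by nlinarith)
        calc Real.exp (-(c * u)) * ‖x₀ + ∫ r in (0 : ℝ)..u, f r (Real.exp (c * r) • w r)‖
            ≤ Real.exp (-(c * u)) * (‖x₀‖ + (M + L * ‖w‖) * (Real.exp (c * u) / c)) := by
              gcongr
              exact (norm_add_le _ _).trans (by gcongr)
          _ = Real.exp (-(c * u)) * ‖x₀‖
              + (M + L * ‖w‖) / c * (Real.exp (-(c * u)) * Real.exp (c * u)) := by ring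
          _ ≤ 1 * ‖x₀‖ + (M + L * ‖w‖) / c * 1 := by
              rw [hexp]; gcongr
          _ = _ := by ring)
  have hΦ : ∀ w s, Φ w s = Real.exp (-(c * max s 0)) •
        (x₀ + ∫ r in (0 : ℝ)..max s 0, f r (Real.exp (c * r) • w r)) := fun w s => rfl
  have hcontr : ContractingWith (1 / 2) Φ := by
    refine ⟨by rw [← NNReal.coe_lt_coe]; norm_num, LipschitzWith.of_dist_le_mul fun w v => ?_⟩
    refine (BoundedContinuousFunction.dist_le (by positivity)).2 fun s => ?_
    rw [hΦ, hΦ, dist_eq_norm, ← smul_sub, add_sub_add_left_eq_sub,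
      ← intervalIntegral.integral_sub (hint w _ _) (hint v _ _), norm_smul,
      Real.norm_of_nonneg (Real.exp_pos _).le]
    set u := max s 0 with hu
    have hu0 : 0 ≤ u := le_max_right _ _
    have h1 : ‖∫ r in (0 : ℝ)..u,
          (f r (Real.exp (c * r) • w r) - f r (Real.exp (c * r) • v r))‖
        ≤ ∫ r in (0 : ℝ)..u, (L * dist w v) * Real.exp (c * r) := by
      apply intervalIntegral.norm_integral_le_of_norm_le hu0
      · refine Eventually.of_forall fun r _ => (hlip r _ _).trans ?_
        rw [← smul_sub, norm_smul, Real.norm_of_nonneg (Real.exp_pos _).le, ← dist_eq_norm]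
        have := BoundedContinuousFunction.dist_coe_le_dist (f := w) (g := v) r
        calc L * (Real.exp (c * r) * dist (w r) (v r)) ≤ L * (Real.exp (c * r) * dist w v) := by
              gcongr
          _ = _ := by ring
      · exact (by fun_prop : Continuous fun r : ℝ =>
          (L * dist w v) * Real.exp (c * r)).intervalIntegrable _ _
    rw [intervalIntegral.integral_const_mul] at h1
    have h3 := h1.trans (mul_le_mul_of_nonneg_left (integral_exp_mul_le (s := u) hc0)
      (by positivity : 0 ≤ L * dist w v))
    refine (mul_le_mul_of_nonneg_left h3 (Real.exp_pos _).le).trans (le_of_eq ?_)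
    calc Real.exp (-(c * u)) * (L * dist w v * (Real.exp (c * u) / c))
        = (Real.exp (-(c * u)) * Real.exp (c * u)) * (L / c) * dist w v := by ring
      _ = _ := by
        rw [hexp, hc]
        have : L / (2 * L) = 1 / 2 := by field_simp
        rw [this]; simp
  obtain ⟨w, hw⟩ : ∃ w, Φ w = w := ⟨_, hcontr.fixedPoint_isFixedPt⟩
  have hz : ∀ s, 0 ≤ s → Real.exp (c * s) • w s
      = x₀ + ∫ r in (0 : ℝ)..s, f r (Real.exp (c * r) • w r) := fun s hs => by
    have h1 : w s = Φ w s := by rw [hw]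
    rw [h1, hΦ, max_eq_left hs, smul_smul, mul_comm, hexp, one_smul]
  refine ⟨fun s => Real.exp (c * s) • w s, ?_, hcurve w, fun s hs => ?_⟩
  · simpa using hz 0 le_rfl
  · have h1 : HasDerivWithinAt (fun u => ∫ r in (0 : ℝ)..u, f r (Real.exp (c * r) • w r))
        (f s (Real.exp (c * s) • w s)) (Ici s) s := by
      apply intervalIntegral.integral_hasDerivWithinAt_right (hint w _ _) (t := Ioi s)
      · exact ⟨univ, univ_mem, (hmeas _ (hcurve w)).restrict⟩
      · exact (hright _ (hcurve w) s).mono Ioi_subset_Ici_self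
    refine (h1.const_add x₀).congr (fun r hr => hz r (hs.trans hr)) (hz s hs)

end ODE

/-! ### Equations switching between finitely many vector fields: existence and dependence on the
initial point. -/

section Switched

variable {ι E F : Type*} [NormedAddCommGroup E] [NormedSpace ℝ E] [NormedAddCommGroup F]

theorem continuousWithinAt_switched {ℓ : ℝ → ι} {s : ℝ} (hr : ∀ᶠ r in 𝓝[≥] s, ℓ r = ℓ s)
    {h : ι → ℝ → F} (hc : ∀ i, Continuous (h i)) :
    ContinuousWithinAt (fun r => h (ℓ r) r) (Ici s) s :=
  (hc (ℓ s)).continuousWithinAt.congr_of_eventuallyEq (hr.mono fun r h => by simp only [h]) rfl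

variable [Fintype ι]

theorem stronglyMeasurable_switched {ℓ : ℝ → ι} (hmeas : ∀ i, MeasurableSet (ℓ ⁻¹' {i}))
    {h : ι → ℝ → F} (hc : ∀ i, Continuous (h i)) : StronglyMeasurable fun s => h (ℓ s) s := by
  classical
  have : (fun s => h (ℓ s) s) = fun s => ∑ i, (ℓ ⁻¹' {i}).indicator (h i) s := by
    funext s
    simp [Set.indicator_apply]
  rw [this]
  exact Finset.stronglyMeasurable_fun_sum _ fun i _ =>
    (hc i).stronglyMeasurable.indicator (hmeas i)

theorem exists_switched_solution [CompleteSpace E] {g : ι → E → E} {L : ℝ} (hL : 0 < L)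
    (hlip : ∀ i x y, ‖g i x - g i y‖ ≤ L * ‖x - y‖)
    {ℓ : ℝ → ι} (hmeas : ∀ i, MeasurableSet (ℓ ⁻¹' {i}))
    (hr : ∀ s, ∀ᶠ r in 𝓝[≥] s, ℓ r = ℓ s) (x₀ : E) :
    ∃ z : ℝ → E, z 0 = x₀ ∧ Continuous z ∧
      ∀ s, 0 ≤ s → HasDerivWithinAt z (g (ℓ s) (z s)) (Ici s) s := by
  have hg : ∀ i, Continuous (g i) := fun i =>
    (LipschitzWith.of_dist_le_mul (K := ⟨L, hL.le⟩) fun x y => by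
      rw [dist_eq_norm, dist_eq_norm]; exact hlip i x y).continuous
  refine exists_forward_solution (f := fun s => g (ℓ s)) (M := ∑ i, ‖g i 0‖) hL
    (fun s => hlip _) (fun s => ?_) (fun z hz => ?_) (fun z hz s => ?_) x₀
  · exact Finset.single_le_sum (f := fun i => ‖g i 0‖) (fun i _ => norm_nonneg _)
      (Finset.mem_univ _)
  · exact (stronglyMeasurable_switched hmeas (h := fun i s => g i (z s))
      fun i => (hg i).comp hz).aestronglyMeasurable
  · exact continuousWithinAt_switched (hr s) (h := fun i s => g i (z s)) fun i => (hg i).comp hz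

theorem norm_le_exp_of_deriv_right {z z' : ℝ → E} {L T : ℝ} (hT : 0 ≤ T)
    (hz : ContinuousOn z (Ici 0)) (hz' : ∀ s, 0 ≤ s → HasDerivWithinAt z (z' s) (Ici s) s)
    (hb : ∀ s, 0 ≤ s → s < T → ‖z' s‖ ≤ L * ‖z s‖) : ‖z T‖ ≤ ‖z 0‖ * Real.exp (L * T) := by
  have := norm_le_gronwallBound_of_norm_deriv_right_le (f := z) (f' := z') (δ := ‖z 0‖) (K := L)
    (ε := 0) (a := 0) (b := T) (hz.mono Icc_subset_Ici_self) (fun x hx => hz' x hx.1) le_rfl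
    (fun x hx => by simpa using hb x hx.1 hx.2) T ⟨hT, le_rfl⟩
  simpa [gronwallBound_ε0] using this

/-- A `C¹` family of maps is uniformly differentiable along a compact set. -/
theorem exists_delta_norm_sub_sub_fderiv_le {g : ι → E → E} (hg : ∀ i, ContDiff ℝ 1 (g i))
    {S : Set E} (hS : IsCompact S) {η : ℝ} (hη : 0 < η) :
    ∃ δ > 0, ∀ i, ∀ x ∈ S, ∀ y, ‖y - x‖ < δ →
      ‖g i y - g i x - fderiv ℝ (g i) x (y - x)‖ ≤ η * ‖y - x‖ := by
  -- Phrased for all small `δ`, so that the finitely many indices can share one `δ`.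
  have key : ∀ i, ∀ᶠ δ in 𝓝[>] (0 : ℝ), ∀ x ∈ S, ∀ y, ‖y - x‖ < δ →
      ‖g i y - g i x - fderiv ℝ (g i) x (y - x)‖ ≤ η * ‖y - x‖ := fun i => by
    have hd : Continuous (fderiv ℝ (g i)) := (hg i).continuous_fderiv one_ne_zero
    have h1 := hS.uniformContinuousAt_of_continuousAt (fderiv ℝ (g i))
      (fun x _ => hd.continuousAt) (Metric.dist_mem_uniformity hη)
    obtain ⟨δ, hδ, hsub⟩ := Metric.mem_uniformity_dist.1 h1
    filter_upwards [Ioo_mem_nhdsGT hδ] with δ' hδ' x hx y hy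
    refine Convex.norm_image_sub_le_of_norm_fderiv_le' (𝕜 := ℝ) (s := Metric.ball x δ)
      (fun z _ => (hg i).differentiable one_ne_zero z) (fun z hz => ?_) (convex_ball _ _)
      (Metric.mem_ball_self hδ) (by rw [Metric.mem_ball, dist_eq_norm]; exact hy.trans hδ'.2)
    have h2 := hsub (a := x) (b := z) (by rw [dist_comm]; exact hz) hx
    simp only [mem_ofPred_eq] at h2
    rw [← dist_eq_norm, dist_comm]
    exact h2.le
  obtain ⟨δ, h1, h2⟩ := ((eventually_all.2 key).and self_mem_nhdsWithin).exists
  exact ⟨δ, h2, fun i => h1 i⟩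

/-- The solutions of a switched equation with `C¹` right-hand sides are differentiable in the
initial point, and the derivative solves the variational equation. -/
theorem exists_hasFDerivAt_switched_solution [CompleteSpace E] {g : ι → E → E} {L : ℝ}
    (hL : 0 < L) (hg : ∀ i, ContDiff ℝ 1 (g i)) (hb : ∀ i x, ‖fderiv ℝ (g i) x‖ ≤ L)
    {ℓ : ℝ → ι} (hmeas : ∀ i, MeasurableSet (ℓ ⁻¹' {i}))
    (hr : ∀ s, ∀ᶠ r in 𝓝[≥] s, ℓ r = ℓ s)
    {X : E → ℝ → E} (hX0 : ∀ x, X x 0 = x) (hXc : ∀ x, ContinuousOn (X x) (Ici 0))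
    (hX : ∀ x s, 0 ≤ s → HasDerivWithinAt (X x) (g (ℓ s) (X x s)) (Ici s) s) (x₀ : E) :
    ∃ Y : ℝ → E →L[ℝ] E, Y 0 = ContinuousLinearMap.id ℝ E ∧ Continuous Y ∧
      (∀ s, 0 ≤ s →
        HasDerivWithinAt Y ((fderiv ℝ (g (ℓ s)) (X x₀ s)).comp (Y s)) (Ici s) s) ∧
      (∀ s, 0 ≤ s → ‖Y s‖ ≤ Real.exp (L * s)) ∧
      ∀ s, 0 ≤ s → HasFDerivAt (fun x => X x s) (Y s) x₀ := by
  have hlip : ∀ i x y, ‖g i x - g i y‖ ≤ L * ‖x - y‖ := fun i x y =>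
    convex_univ.norm_image_sub_le_of_norm_fderiv_le (𝕜 := ℝ)
      (fun z _ => (hg i).differentiable one_ne_zero z) (fun z _ => hb i z) (mem_univ _)
      (mem_univ _)
  -- The solution is only controlled for `s ≥ 0`, whereas `exists_forward_solution` wants
  -- coefficients on the whole line.
  have hcurve : Continuous fun s => X x₀ (max s 0) :=
    (hXc x₀).comp_continuous (by fun_prop) fun s => mem_Ici.2 (le_max_right _ _)
  have hA : ∀ i, Continuous fun s => fderiv ℝ (g i) (X x₀ (max s 0)) := fun i =>
    ((hg i).continuous_fderiv one_ne_zero).comp hcurve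
  obtain ⟨Y, hY0, hYc, hY'⟩ := exists_forward_solution (E := E →L[ℝ] E)
    (f := fun s B => (fderiv ℝ (g (ℓ s)) (X x₀ (max s 0))).comp B) (L := L) (M := 0) hL
    (fun s B B' => by
      rw [← ContinuousLinearMap.comp_sub]
      exact (ContinuousLinearMap.opNorm_comp_le _ _).trans (by gcongr; exact hb _ _))
    (fun s => by simp)
    (fun z hz => (stronglyMeasurable_switched hmeas
      (h := fun i s => (fderiv ℝ (g i) (X x₀ (max s 0))).comp (z s))
      fun i => (hA i).clm_comp hz).aestronglyMeasurable)
    (fun z hz s => continuousWithinAt_switched (hr s)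
      (h := fun i s => (fderiv ℝ (g i) (X x₀ (max s 0))).comp (z s))
      fun i => (hA i).clm_comp hz) (ContinuousLinearMap.id ℝ E)
  have hYd : ∀ s, 0 ≤ s →
      HasDerivWithinAt Y ((fderiv ℝ (g (ℓ s)) (X x₀ s)).comp (Y s)) (Ici s) s := fun s hs => by
    simpa only [max_eq_left hs] using hY' s hs
  refine ⟨Y, hY0, hYc, hYd, fun s hs => ?_, fun T hT => ?_⟩
  · have := norm_le_exp_of_deriv_right (L := L) hs hYc.continuousOn hYd (fun r _ _ =>
      (ContinuousLinearMap.opNorm_comp_le _ _).trans (by gcongr; exact hb _ _))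
    refine this.trans ?_
    rw [hY0]
    exact mul_le_of_le_one_left (Real.exp_pos _).le ContinuousLinearMap.norm_id_le
  · have hdist : ∀ x s, 0 ≤ s → ‖X x s - X x₀ s‖ ≤ ‖x - x₀‖ * Real.exp (L * s) := fun x s hs => by
      have := norm_le_exp_of_deriv_right (L := L) (z := fun s => X x s - X x₀ s) hs
        ((hXc x).sub (hXc x₀)) (fun r hr => (hX x r hr).sub (hX x₀ r hr)) (fun r _ _ => hlip _ _ _)
      simpa [hX0] using this
    rw [hasFDerivAt_iff_isLittleO, Asymptotics.isLittleO_iff]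
    intro κ hκ
    -- Of the two factors `exp (L T)` to be absorbed, one comes from the separation of the two
    -- solutions and one from Grönwall for the linearization error; Grönwall also divides by `L`.
    set η : ℝ := κ * L * Real.exp (-(2 * L * T)) with hη
    have hη0 : 0 < η := by positivity
    have hS : IsCompact (X x₀ '' Icc 0 T) :=
      isCompact_Icc.image_of_continuousOn ((hXc x₀).mono Icc_subset_Ici_self)
    obtain ⟨δ, hδ, hunif⟩ := exists_delta_norm_sub_sub_fderiv_le hg hS hη0
    have hnear : ∀ᶠ x in 𝓝 x₀, ‖x - x₀‖ * Real.exp (L * T) < δ := by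
      have : Tendsto (fun x => ‖x - x₀‖ * Real.exp (L * T)) (𝓝 x₀) (𝓝 0) := by
        have h : Continuous fun x => ‖x - x₀‖ * Real.exp (L * T) := by fun_prop
        simpa using h.tendsto x₀
      exact this.eventually_lt_const hδ
    filter_upwards [hnear] with x hx
    have hexp : ∀ s, s ≤ T → Real.exp (L * s) ≤ Real.exp (L * T) := fun s hs =>
      Real.exp_le_exp.2 (by gcongr)
    have hgron := norm_le_gronwallBound_of_norm_deriv_right_le
      (f := fun s => X x s - X x₀ s - Y s (x - x₀))
      (f' := fun s => g (ℓ s) (X x s) - g (ℓ s) (X x₀ s)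
        - (fderiv ℝ (g (ℓ s)) (X x₀ s)).comp (Y s) (x - x₀))
      (δ := 0) (K := L) (ε := η * (‖x - x₀‖ * Real.exp (L * T))) (a := 0) (b := T)
      ((((hXc x).sub (hXc x₀)).mono Icc_subset_Ici_self).sub
        (hYc.clm_apply continuous_const).continuousOn)
      (fun s hs => ((hX x s hs.1).sub (hX x₀ s hs.1)).sub
        (by simpa using (hYd s hs.1).clm_apply (hasDerivWithinAt_const s (Ici s) (x - x₀))))
      (by simp [hX0, hY0])
      (fun s hs => by
        have h1 := hdist x s hs.1
        have h2 : ‖X x s - X x₀ s‖ ≤ ‖x - x₀‖ * Real.exp (L * T) :=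
          h1.trans (by gcongr; exact hs.2.le)
        have h3 := hunif (ℓ s) (X x₀ s) (mem_image_of_mem _ ⟨hs.1, hs.2.le⟩) (X x s)
          (h2.trans_lt hx)
        set A := fderiv ℝ (g (ℓ s)) (X x₀ s) with hA
        have h4 : g (ℓ s) (X x s) - g (ℓ s) (X x₀ s) - A.comp (Y s) (x - x₀)
            = A (X x s - X x₀ s - Y s (x - x₀))
              + (g (ℓ s) (X x s) - g (ℓ s) (X x₀ s) - A (X x s - X x₀ s)) := by
          simp only [ContinuousLinearMap.comp_apply, map_sub]
          abel
        rw [h4]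
        refine (norm_add_le _ _).trans (add_le_add ((A.le_opNorm _).trans ?_) (h3.trans ?_))
        · gcongr
          exact hb _ _
        · gcongr)
      T ⟨hT, le_rfl⟩
    rw [gronwallBound_of_K_ne_0 hL.ne'] at hgron
    simp only [zero_mul, zero_add, sub_zero] at hgron ⊢
    refine hgron.trans ?_
    have he : Real.exp (-(2 * L * T)) * (Real.exp (L * T) * Real.exp (L * T)) = 1 := by
      rw [← Real.exp_add, ← Real.exp_add]; ring_nf; simp
    calc η * (‖x - x₀‖ * Real.exp (L * T)) / L * (Real.exp (L * T) - 1)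
        ≤ η * (‖x - x₀‖ * Real.exp (L * T)) / L * Real.exp (L * T) := by
          gcongr; linarith
      _ = κ * ‖x - x₀‖ * (Real.exp (-(2 * L * T)) * (Real.exp (L * T) * Real.exp (L * T))) := by
          rw [hη]; field_simp
      _ = _ := by rw [he, mul_one]

end Switched

/-! ### Potentials with bounded second derivatives -/

section Potential

variable {m : ℕ} {U : Space m → ℝ} {C : ℝ}

theorem secondPartial_eq_fderiv (U : Space m → ℝ) (x : Space m) (i j : Fin m) :
    secondPartial U x i j
      = fderiv ℝ (fderiv ℝ U) x (EuclideanSpace.single i 1) (EuclideanSpace.single j 1) := by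
  simp [secondPartial, iteratedFDeriv_two_apply]

theorem Subquadratic.add_const (hU : Subquadratic C U) (c : ℝ) :
    Subquadratic C fun x => U x + c := by
  refine ⟨hU.1.add contDiff_const, fun x i j => ?_⟩
  have h : fderiv ℝ (fun x => U x + c) = fderiv ℝ U := by
    funext y; exact fderiv_add_const c
  have := hU.2 x i j
  rwa [secondPartial_eq_fderiv, h, ← secondPartial_eq_fderiv]

theorem sum_smul_single (v : Space m) :
    ∑ i, v i • (EuclideanSpace.single i 1 : Space m) = v := by
  have := (EuclideanSpace.basisFun (Fin m) ℝ).sum_repr v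
  simpa using this

/-- Coordinates let the gradient inherit smoothness and its derivative from `fderiv`. -/
theorem gradient_eq_sum (hU : Subquadratic C U) (x : Space m) :
    gradient U x = ∑ i, fderiv ℝ U x (EuclideanSpace.single i 1) •
      (EuclideanSpace.single i 1 : Space m) := by
  have hd : DifferentiableAt ℝ U x := hU.1.differentiable (by simp) x
  rw [← sum_smul_single (gradient U x)]
  refine Finset.sum_congr rfl fun i _ => ?_
  congr 1
  have h1 : inner ℝ (gradient U x) (EuclideanSpace.single i (1 : ℝ))
      = fderiv ℝ U x (EuclideanSpace.single i 1) := by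
    rw [gradient, InnerProductSpace.toDual_symm_apply]
  rw [← h1, EuclideanSpace.inner_single_right]
  simp

/-- The derivative of the gradient. -/
def hessianMap (U : Space m → ℝ) (x : Space m) : Space m →L[ℝ] Space m :=
  ∑ i, ((fderiv ℝ (fderiv ℝ U) x).flip (EuclideanSpace.single i 1)).smulRight
    (EuclideanSpace.single i 1 : Space m)

theorem hessianMap_apply (U : Space m → ℝ) (x v : Space m) :
    hessianMap U x v = ∑ i, fderiv ℝ (fderiv ℝ U) x v (EuclideanSpace.single i 1) •
      (EuclideanSpace.single i 1 : Space m) := by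
  simp [hessianMap]

theorem contDiff_fderiv (hU : Subquadratic C U) : ContDiff ℝ 1 (fderiv ℝ U) :=
  (contDiff_infty.1 hU.1 2).fderiv_right (by norm_num)

theorem contDiff_gradient (hU : Subquadratic C U) : ContDiff ℝ 1 (gradient U) := by
  rw [funext (gradient_eq_sum hU)]
  exact ContDiff.sum fun i _ => ((contDiff_fderiv hU).clm_apply contDiff_const).smul contDiff_const

theorem hasFDerivAt_gradient (hU : Subquadratic C U) (x : Space m) :
    HasFDerivAt (gradient U) (hessianMap U x) x := by
  rw [funext (gradient_eq_sum hU)]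
  refine HasFDerivAt.fun_sum fun i _ => ?_
  have h1 := ((contDiff_fderiv hU).differentiable one_ne_zero x).hasFDerivAt
  have h2 := (h1.clm_apply
    (hasFDerivAt_const (EuclideanSpace.single i (1 : ℝ) : Space m) x)).smul_const
    (EuclideanSpace.single i (1 : ℝ) : Space m)
  refine h2.congr_fderiv ?_
  ext v
  simp

theorem inner_hessianMap (U : Space m → ℝ) (x v w : Space m) :
    inner ℝ (hessianMap U x v) w = fderiv ℝ (fderiv ℝ U) x v w := by
  conv_rhs => rw [← sum_smul_single w]
  rw [hessianMap_apply, sum_inner, map_sum]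
  refine Finset.sum_congr rfl fun i _ => ?_
  rw [inner_smul_left, EuclideanSpace.inner_single_left, map_smul]
  simp [mul_comm]

/-- Symmetry of second derivatives; this is the source of symplecticity of the flow. -/
theorem inner_hessianMap_comm (hU : Subquadratic C U) (x v w : Space m) :
    inner ℝ (hessianMap U x v) w = inner ℝ v (hessianMap U x w) := by
  rw [real_inner_comm (hessianMap U x w) v, inner_hessianMap, inner_hessianMap]
  exact ((contDiff_infty.1 hU.1 2).contDiffAt.isSymmSndFDerivAt (by simp)).eq v w

theorem norm_single_one (i : Fin m) : ‖(EuclideanSpace.single i 1 : Space m)‖ = 1 := by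
  simp

theorem abs_apply_le_norm (v : Space m) (i : Fin m) : |v i| ≤ ‖v‖ := by
  simpa using PiLp.norm_apply_le v i

theorem norm_hessianMap_apply_le (hC : 0 ≤ C) (hU : Subquadratic C U) (x v : Space m) :
    ‖hessianMap U x v‖ ≤ (m : ℝ) ^ 2 * C * ‖v‖ := by
  have h : ∀ i, |fderiv ℝ (fderiv ℝ U) x v (EuclideanSpace.single i 1)| ≤ m * (C * ‖v‖) :=
    fun i => by
      conv_lhs => rw [← sum_smul_single v]
      rw [map_sum, sum_apply]
      refine (Finset.abs_sum_le_sum_abs _ _).trans ?_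
      refine (Finset.sum_le_card_nsmul _ _ (C * ‖v‖) fun j _ => ?_).trans (by simp)
      rw [map_smul, smul_apply, smul_eq_mul, abs_mul, mul_comm]
      have := hU.2 x j i
      rw [secondPartial_eq_fderiv] at this
      exact mul_le_mul this (abs_apply_le_norm v j) (abs_nonneg _) hC
  rw [hessianMap_apply]
  refine (norm_sum_le _ _).trans ?_
  refine (Finset.sum_le_card_nsmul _ _ (m * (C * ‖v‖)) fun i _ => ?_).trans (le_of_eq ?_)
  · rw [norm_smul, norm_single_one, mul_one]
    exact h i
  · simp; ring

end Potential

/-! ### Linear symplectic maps -/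

section Symplectic

variable {m : ℕ}

/-- The standard symplectic form on phase space. -/
def symplecticForm (u v : Phase m) : ℝ := inner ℝ u.1 v.2 - inner ℝ u.2 v.1

/-- The matrix of the derivatives `∂_q - i ∂_p` of the components of a linear map. -/
def dzMap (B : Phase m →L[ℝ] Space m) : Matrix (Fin m) (Fin m) ℂ :=
  Matrix.of fun j k =>
    ((B (EuclideanSpace.single j 1, 0) k : ℝ) : ℂ)
      - Complex.I * ((B (0, EuclideanSpace.single j 1) k : ℝ) : ℂ)

theorem dz_eq_dzMap {F : Phase m → Space m} {B : Phase m →L[ℝ] Space m} {z : Phase m}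
    (h : HasFDerivAt F B z) : dz F z = dzMap B := by
  rw [dz, h.fderiv]; rfl

theorem norm_dzMap_apply_le {B : Phase m →L[ℝ] Space m} {b : ℝ} (hB : ‖B‖ ≤ b) (j k : Fin m) :
    ‖dzMap B j k‖ ≤ 2 * b := by
  have h1 : ∀ u : Phase m, ‖u‖ ≤ 1 → |B u k| ≤ b := fun u hu =>
    (abs_apply_le_norm _ _).trans ((B.le_opNorm u).trans
      ((mul_le_of_le_one_right (norm_nonneg _) hu).trans hB))
  rw [dzMap, Matrix.of_apply]
  refine (norm_sub_le _ _).trans ?_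
  rw [norm_mul, Complex.norm_I, one_mul, Complex.norm_real, Complex.norm_real, two_mul]
  exact add_le_add (h1 _ (by simp [Prod.norm_def])) (h1 _ (by simp [Prod.norm_def]))

theorem apply_eq_sum (B : Phase m →L[ℝ] Space m) (α β : Space m) (k : Fin m) :
    B (α, β) k = ∑ j, (α j * B (EuclideanSpace.single j 1, 0) k
      + β j * B (0, EuclideanSpace.single j 1) k) := by
  have h : (α, β) = ∑ j, (α j • ((EuclideanSpace.single j 1, 0) : Phase m)
      + β j • ((0, EuclideanSpace.single j 1) : Phase m)) := by
    refine Prod.ext ?_ ?_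
    · simp [Prod.fst_sum, sum_smul_single]
    · simp [Prod.snd_sum, sum_smul_single]
  rw [h, map_sum]
  simp only [map_add, map_smul]
  simp

/-- For a symplectic map with components `Q` and `P`, the matrix `∂_z (Q + i P)` is bounded
below. -/
theorem two_mul_sum_norm_sq_le {B : Phase m →L[ℝ] Phase m}
    (hB : ∀ u v, symplecticForm (B u) (B v) = symplecticForm u v) (ξ : Fin m → ℂ) :
    2 * ∑ j, ‖ξ j‖ ^ 2 ≤ ∑ k, ‖Matrix.vecMul ξ
      (dzMap ((ContinuousLinearMap.fst ℝ _ _).comp B)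
        + Complex.I • dzMap ((ContinuousLinearMap.snd ℝ _ _).comp B)) k‖ ^ 2 := by
  -- With `ξ = α + i β`, `u = B (α, β)` and `v = B (β, -α)`, the row vector `ξ Z` is `(u.1 - v.2) +
  -- i (v.1 + u.2)`. Its squared length is the sum of the squared norms of the four components minus
  -- twice the symplectic form of `u` and `v`, and that form equals `-|ξ|²` because `B` preserves
  -- it.
  set α : Space m := WithLp.toLp 2 fun j => (ξ j).re with hα
  set β : Space m := WithLp.toLp 2 fun j => (ξ j).im with hβ
  set u := B (α, β) with hu
  set v := B (β, -α) with hv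
  have hξ : ∀ j, ξ j = α j + Complex.I * β j := fun j => by
    rw [mul_comm]; exact (Complex.re_add_im _).symm
  have hcomp : ∀ k, Matrix.vecMul ξ
      (dzMap ((ContinuousLinearMap.fst ℝ _ _).comp B)
        + Complex.I • dzMap ((ContinuousLinearMap.snd ℝ _ _).comp B)) k
      = ((u.1 - v.2) k : ℝ) + ((v.1 + u.2) k : ℝ) * Complex.I := fun k => by
    have e1 := apply_eq_sum ((ContinuousLinearMap.fst ℝ _ _).comp B) α β k
    have e2 := apply_eq_sum ((ContinuousLinearMap.snd ℝ _ _).comp B) α β k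
    have e3 := apply_eq_sum ((ContinuousLinearMap.fst ℝ _ _).comp B) β (-α) k
    have e4 := apply_eq_sum ((ContinuousLinearMap.snd ℝ _ _).comp B) β (-α) k
    simp only [ContinuousLinearMap.comp_apply, ContinuousLinearMap.coe_fst',
      ContinuousLinearMap.coe_snd'] at e1 e2 e3 e4
    rw [PiLp.sub_apply, PiLp.add_apply, hu, hv, e1, e2, e3, e4]
    simp only [Matrix.vecMul, dotProduct, dzMap, Matrix.add_apply, Matrix.smul_apply,
      Matrix.of_apply, ContinuousLinearMap.comp_apply, ContinuousLinearMap.coe_fst',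
      ContinuousLinearMap.coe_snd', smul_eq_mul]
    push_cast
    rw [← Finset.sum_sub_distrib, ← Finset.sum_add_distrib, Finset.sum_mul,
      ← Finset.sum_add_distrib]
    refine Finset.sum_congr rfl fun j _ => ?_
    rw [hξ j, PiLp.neg_apply]
    push_cast
    linear_combination (-(α j : ℂ) * ((B (0, EuclideanSpace.single j 1)).2 k : ℂ)
      - (β j : ℂ) * ((B (0, EuclideanSpace.single j 1)).1 k : ℂ)
      + (β j : ℂ) * ((B (EuclideanSpace.single j 1, 0)).2 k : ℂ)
      - (β j : ℂ) * Complex.I * ((B (0, EuclideanSpace.single j 1)).2 k : ℂ)) * Complex.I_sq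
  have hsq : ∀ k, ‖Matrix.vecMul ξ
      (dzMap ((ContinuousLinearMap.fst ℝ _ _).comp B)
        + Complex.I • dzMap ((ContinuousLinearMap.snd ℝ _ _).comp B)) k‖ ^ 2
      = (u.1 - v.2) k ^ 2 + (v.1 + u.2) k ^ 2 := fun k => by
    rw [hcomp, ← Complex.normSq_eq_norm_sq, Complex.normSq_add_mul_I]
  have hξsq : ∑ j, ‖ξ j‖ ^ 2 = ‖α‖ ^ 2 + ‖β‖ ^ 2 := by
    rw [EuclideanSpace.real_norm_sq_eq, EuclideanSpace.real_norm_sq_eq, ← Finset.sum_add_distrib]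
    refine Finset.sum_congr rfl fun j _ => ?_
    rw [← Complex.normSq_eq_norm_sq, Complex.normSq_apply, hα, hβ]
    simp [sq]
  have hω := hB (α, β) (β, -α)
  rw [← hu, ← hv] at hω
  simp only [symplecticForm, inner_neg_right, real_inner_self_eq_norm_sq] at hω
  have h1 := norm_sub_sq_real u.1 v.2
  have h2 := norm_add_sq_real v.1 u.2
  rw [real_inner_comm] at h2
  rw [Finset.sum_congr rfl fun k _ => hsq k, Finset.sum_add_distrib,
    ← EuclideanSpace.real_norm_sq_eq, ← EuclideanSpace.real_norm_sq_eq, hξsq]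
  nlinarith [sq_nonneg ‖u.1‖, sq_nonneg ‖u.2‖, sq_nonneg ‖v.1‖, sq_nonneg ‖v.2‖]

/-- A row `η` of `M Z⁻¹` satisfies `η Z = M i`, so the lower bound on `Z` controls `η` by the row `M
i`. Cyclicity of the trace brings in `M Z⁻¹`. -/
theorem norm_trace_inv_mul_le {Z M : Matrix (Fin m) (Fin m) ℂ}
    (hZ : ∀ ξ : Fin m → ℂ, 2 * ∑ j, ‖ξ j‖ ^ 2 ≤ ∑ k, ‖Matrix.vecMul ξ Z k‖ ^ 2)
    {b : ℝ} (hb : 0 ≤ b) (hM : ∀ j k, ‖M j k‖ ≤ b) :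
    ‖Matrix.trace (Z⁻¹ * M)‖ ≤ (m : ℝ) ^ 2 * b := by
  by_cases hdet : IsUnit Z.det
  · rw [Matrix.trace_mul_comm, Matrix.trace]
    refine (norm_sum_le _ _).trans ?_
    refine (Finset.sum_le_card_nsmul _ _ (m * b) fun i _ => ?_).trans (le_of_eq (by simp; ring))
    have hrow := hZ fun j => (M * Z⁻¹) i j
    have h1 : Matrix.vecMul (fun j => (M * Z⁻¹) i j) Z = M i := by
      have : (fun j => (M * Z⁻¹) i j) = Matrix.vecMul (M i) Z⁻¹ := rfl
      rw [this, Matrix.vecMul_vecMul, Matrix.nonsing_inv_mul _ hdet, Matrix.vecMul_one]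
    rw [h1] at hrow
    have h2 : ∑ k, ‖M i k‖ ^ 2 ≤ m * b ^ 2 := by
      refine (Finset.sum_le_card_nsmul _ _ (b ^ 2) fun k _ => ?_).trans (by simp)
      have := hM i k
      gcongr
    have h3 : ‖(M * Z⁻¹) i i‖ ^ 2 ≤ ∑ j, ‖(M * Z⁻¹) i j‖ ^ 2 :=
      Finset.single_le_sum (f := fun j => ‖(M * Z⁻¹) i j‖ ^ 2) (fun _ _ => sq_nonneg _)
        (Finset.mem_univ i)
    have h4 : (1 : ℝ) ≤ m := by exact_mod_cast Fin.pos i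
    refine abs_le_of_sq_le_sq' ?_ (by positivity) |>.2
    rw [Matrix.diag_apply]
    nlinarith [sq_nonneg b, mul_nonneg (sub_nonneg.2 h4) (sq_nonneg b), sq_nonneg ‖(M * Z⁻¹) i i‖]
  -- `hZ` excludes a singular `Z`, but the inverse is then `0` by convention and the bound is
  -- immediate.
  · rw [Matrix.nonsing_inv_apply_not_isUnit _ hdet, zero_mul, Matrix.trace_zero, norm_zero]
    positivity

end Symplectic

/-! ### Surface paths -/

/-- Each of the finitely many conditions `time j ≤ s` is locally constant to the right; the hop
times need not be ordered. -/
theorem History.eventually_surfaceAt_eq {N : ℕ} (H : History N) (s : ℝ) :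
    ∀ᶠ r in 𝓝[≥] s, H.surfaceAt r = H.surfaceAt s := by
  have h : ∀ᶠ r in 𝓝[≥] s, ∀ j ∈ Finset.Icc 1 H.hops, (H.time j ≤ r ↔ H.time j ≤ s) := by
    refine (Filter.eventually_all_finset _).2 fun j _ => ?_
    rcases le_or_gt (H.time j) s with hj | hj
    · filter_upwards [self_mem_nhdsWithin] with r hr
      exact ⟨fun _ => hj, fun _ => hj.trans hr⟩
    · filter_upwards [mem_nhdsWithin_of_mem_nhds (Iio_mem_nhds hj)] with r hr
      exact ⟨fun h => absurd h (not_le.2 hr), fun h => absurd h (not_le.2 hj)⟩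
  filter_upwards [h] with r hr
  rw [History.surfaceAt, History.surfaceAt, Finset.filter_congr hr]

theorem History.measurableSet_surfaceAt_preimage {N : ℕ} (H : History N) (i : Surface N) :
    MeasurableSet (H.surfaceAt ⁻¹' {i}) := by
  have hmono : Monotone fun s : ℝ =>
      ((Finset.Icc 1 H.hops).filter fun j => H.time j ≤ s).card := fun s r hsr =>
    Finset.card_le_card (Finset.monotone_filter_right _ fun j _ hj => le_trans hj hsr)
  exact hmono.measurable (MeasurableSet.of_discrete (s := H.surface ⁻¹' {i}))

namespace Model

variable {m N : ℕ} {D : Model m N} {C : ℝ}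

theorem subquadratic_potential (h0 : Subquadratic C D.U0) (h1 : Subquadratic C D.U1)
    (l : Surface N) : Subquadratic C (D.potential l) := by
  cases l with
  | none => exact h0
  | some k => exact h1.add_const _

/-! ### The Hamiltonian vector fields -/

/-- The derivative of the Hamiltonian vector field of a surface. -/
def fieldDeriv (D : Model m N) (l : Surface N) (z : Phase m) : Phase m →L[ℝ] Phase m :=
  (ContinuousLinearMap.snd ℝ (Space m) (Space m)).prod
    (-((hessianMap (D.potential l) z.1).comp (ContinuousLinearMap.fst ℝ (Space m) (Space m))))

theorem fieldDeriv_apply (l : Surface N) (z u : Phase m) :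
    D.fieldDeriv l z u = (u.2, -hessianMap (D.potential l) z.1 u.1) := rfl

theorem hasFDerivAt_field {l : Surface N} (hU : Subquadratic C (D.potential l)) (z : Phase m) :
    HasFDerivAt (D.field l) (D.fieldDeriv l z) z :=
  hasFDerivAt_snd.prodMk (((hasFDerivAt_gradient hU z.1).comp z hasFDerivAt_fst).neg)

theorem contDiff_field {l : Surface N} (hU : Subquadratic C (D.potential l)) :
    ContDiff ℝ 1 (D.field l) :=
  contDiff_snd.prodMk ((contDiff_gradient hU).comp contDiff_fst).neg

/-- A Lipschitz constant of the Hamiltonian vector fields in dimension `m`, for potentials whose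
second partial derivatives are bounded by `C`. -/
def fieldBound (m : ℕ) (C : ℝ) : ℝ := 1 + (m : ℝ) ^ 2 * C

theorem norm_fieldDeriv_le (hC : 0 ≤ C) {l : Surface N} (hU : Subquadratic C (D.potential l))
    (z : Phase m) : ‖D.fieldDeriv l z‖ ≤ fieldBound m C := by
  have hm : 0 ≤ (m : ℝ) ^ 2 * C := by positivity
  refine ContinuousLinearMap.opNorm_le_bound _ (by unfold fieldBound; positivity) fun u => ?_
  have h1 : ‖u.1‖ ≤ ‖u‖ := norm_fst_le u
  have h2 : ‖u.2‖ ≤ ‖u‖ := norm_snd_le u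
  have h3 := norm_hessianMap_apply_le hC hU z.1 u.1
  rw [fieldDeriv_apply, Prod.norm_def, norm_neg, fieldBound]
  refine max_le ?_ ?_
  · nlinarith [mul_nonneg hm (norm_nonneg u)]
  · nlinarith [mul_le_mul_of_nonneg_left h1 hm, norm_nonneg u]

/-- The infinitesimal form of symplecticity: along the variational equation this sum is the
derivative of the symplectic form of two solutions. -/
theorem symplecticForm_fieldDeriv {l : Surface N} (hU : Subquadratic C (D.potential l))
    (z u v : Phase m) : symplecticForm (D.fieldDeriv l z u) v
      + symplecticForm u (D.fieldDeriv l z v) = 0 := by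
  simp only [symplecticForm, fieldDeriv_apply, inner_neg_left, inner_neg_right]
  rw [inner_hessianMap_comm hU]
  ring

/-! ### The flow and its derivative -/

section Flow

variable {H : History N}

/-- Existence of a solution rules out the default branch in the definition of `flow`. -/
theorem isPath_flow (hC : 0 ≤ C) (hU : ∀ l, Subquadratic C (D.potential l)) (z₀ : Phase m) :
    D.IsPath H.surfaceAt z₀ fun s => D.flow H.surfaceAt s z₀ := by
  have hL : 0 < fieldBound m C := by unfold fieldBound; positivity
  have hex : ∃ z, D.IsPath H.surfaceAt z₀ z := by
    obtain ⟨z, h0, hc, h'⟩ := exists_switched_solution (g := D.field) hL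
      (fun l x y => convex_univ.norm_image_sub_le_of_norm_hasFDerivWithin_le (𝕜 := ℝ)
        (fun z _ => (hasFDerivAt_field (hU l) z).hasFDerivWithinAt)
        (fun z _ => norm_fieldDeriv_le hC (hU l) z) (mem_univ _) (mem_univ _))
      H.measurableSet_surfaceAt_preimage H.eventually_surfaceAt_eq z₀
    exact ⟨z, h0, hc.continuousOn, h'⟩
  have : (fun s => D.flow H.surfaceAt s z₀) = hex.choose := by
    funext s
    rw [flow, dif_pos hex]
  rw [this]
  exact hex.choose_spec

/-- The flow is differentiable in the initial point; its derivative is symplectic and grows at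
most exponentially. -/
theorem exists_hasFDerivAt_flow (hC : 0 ≤ C) (hU : ∀ l, Subquadratic C (D.potential l))
    (z₀ : Phase m) {s : ℝ} (hs : 0 ≤ s) :
    ∃ B : Phase m →L[ℝ] Phase m, HasFDerivAt (D.flow H.surfaceAt s) B z₀ ∧
      ‖B‖ ≤ Real.exp (fieldBound m C * s) ∧
      ∀ u v, symplecticForm (B u) (B v) = symplecticForm u v := by
  have hL : 0 < fieldBound m C := by unfold fieldBound; positivity
  have hpath := isPath_flow (H := H) hC hU
  have hfd : ∀ l z, fderiv ℝ (D.field l) z = D.fieldDeriv l z := fun l z =>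
    (hasFDerivAt_field (hU l) z).fderiv
  obtain ⟨Y, hY0, hYc, hY', hYb, hYd⟩ := exists_hasFDerivAt_switched_solution (g := D.field) hL
    (fun l => contDiff_field (hU l))
    (fun l z => by rw [hfd]; exact norm_fieldDeriv_le hC (hU l) z)
    H.measurableSet_surfaceAt_preimage H.eventually_surfaceAt_eq
    (X := fun z s => D.flow H.surfaceAt s z)
    (fun z => (hpath z).1) (fun z => (hpath z).2.1) (fun z => (hpath z).2.2) z₀
  refine ⟨Y s, hYd s hs, hYb s hs, fun u v => ?_⟩
  have happ : ∀ w, Continuous fun r => Y r w := fun w => hYc.clm_apply continuous_const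
  have hder : ∀ w r, 0 ≤ r → HasDerivWithinAt (fun r => Y r w)
      (D.fieldDeriv (H.surfaceAt r) (D.flow H.surfaceAt r z₀) (Y r w)) (Ici r) r :=
    fun w r hr => by
      have := (hY' r hr).clm_apply (hasDerivWithinAt_const r (Ici r) w)
      simpa [hfd] using this
  have hconst := constant_of_has_deriv_right_zero (a := 0) (b := s)
    (f := fun r => symplecticForm (Y r u) (Y r v))
    (((happ u).fst.inner (happ v).snd).sub ((happ u).snd.inner (happ v).fst)).continuousOn
    (fun r hr => by
      have h1 : ∀ w, HasDerivWithinAt (fun r => (Y r w).1) _ (Ici r) r := fun w =>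
        (ContinuousLinearMap.fst ℝ (Space m) (Space m)).hasFDerivAt.comp_hasDerivWithinAt r
          (hder w r hr.1)
      have h2 : ∀ w, HasDerivWithinAt (fun r => (Y r w).2) _ (Ici r) r := fun w =>
        (ContinuousLinearMap.snd ℝ (Space m) (Space m)).hasFDerivAt.comp_hasDerivWithinAt r
          (hder w r hr.1)
      have h := ((h1 u).inner ℝ (h2 v)).sub ((h2 u).inner ℝ (h1 v))
      refine h.congr_deriv ?_
      rw [← symplecticForm_fieldDeriv (hU (H.surfaceAt r)) (D.flow H.surfaceAt r z₀) (Y r u)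
        (Y r v)]
      simp only [symplecticForm, ContinuousLinearMap.coe_fst', ContinuousLinearMap.coe_snd']
      ring)
    s ⟨hs, le_rfl⟩
  simpa [hY0] using hconst

/-- The growth rate of the amplitudes up to time `t`. -/
def amplitudeRateBound (m : ℕ) (C t : ℝ) : ℝ :=
  (m : ℝ) ^ 2 * ((1 + m * C) * Real.exp (fieldBound m C * t))

theorem norm_amplitudeRate_le (hC : 0 ≤ C) (hU : ∀ l, Subquadratic C (D.potential l))
    (z₀ : Phase m) {s t : ℝ} (hs : 0 ≤ s) (hst : s ≤ t) :
    ‖D.amplitudeRate H.surfaceAt s z₀‖ ≤ amplitudeRateBound m C t := by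
  obtain ⟨B, hB, hBn, hBs⟩ := exists_hasFDerivAt_flow (H := H) hC hU z₀ hs
  set e := Real.exp (fieldBound m C * t) with he
  have hBe : ‖B‖ ≤ e := hBn.trans (Real.exp_le_exp.2 (by
    have : 0 ≤ fieldBound m C := by unfold fieldBound; positivity
    gcongr))
  have hQ : dz (D.Q H.surfaceAt s) z₀ = dzMap ((ContinuousLinearMap.fst ℝ _ _).comp B) :=
    dz_eq_dzMap hB.fst
  have hP : dz (D.P H.surfaceAt s) z₀ = dzMap ((ContinuousLinearMap.snd ℝ _ _).comp B) :=
    dz_eq_dzMap hB.snd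
  have hQn : ‖(ContinuousLinearMap.fst ℝ (Space m) (Space m)).comp B‖ ≤ e :=
    (ContinuousLinearMap.opNorm_comp_le _ _).trans
      ((mul_le_of_le_one_left (norm_nonneg _) (ContinuousLinearMap.norm_fst_le _ _ _)).trans hBe)
  have hPn : ‖(ContinuousLinearMap.snd ℝ (Space m) (Space m)).comp B‖ ≤ e :=
    (ContinuousLinearMap.opNorm_comp_le _ _).trans
      ((mul_le_of_le_one_left (norm_nonneg _) (ContinuousLinearMap.norm_snd_le _ _ _)).trans hBe)
  have he0 : 0 ≤ e := (Real.exp_pos _).le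
  rw [amplitudeRate, Z, hQ, hP, norm_mul]
  have htr := norm_trace_inv_mul_le (two_mul_sum_norm_sq_le hBs)
    (M := dzMap ((ContinuousLinearMap.snd ℝ _ _).comp B)
      - Complex.I • (dzMap ((ContinuousLinearMap.fst ℝ _ _).comp B) * D.hessian H.surfaceAt s z₀))
    -- Entries of `∂_z Q` and `∂_z P` are at most `2 e`; the product with the Hessian sums `m` terms
    -- of size `2 e C`.
    (b := 2 * e + m * (2 * e * C)) (by positivity) (fun j k => by
      rw [Matrix.sub_apply, Matrix.smul_apply]
      refine (norm_sub_le _ _).trans (add_le_add (norm_dzMap_apply_le hPn j k) ?_)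
      rw [norm_smul, Complex.norm_I, one_mul, Matrix.mul_apply]
      refine (norm_sum_le _ _).trans ?_
      refine (Finset.sum_le_card_nsmul _ _ (2 * e * C) fun i _ => ?_).trans (by simp)
      rw [norm_mul, hessian, Matrix.of_apply, Complex.norm_real]
      exact mul_le_mul (norm_dzMap_apply_le hQn j i) ((hU _).2 _ i k) (norm_nonneg _)
        (by positivity))
  have h2 : ‖(1 / 2 : ℂ)‖ = 1 / 2 := by norm_num
  rw [h2, amplitudeRateBound]
  calc _ ≤ 1 / 2 * ((m : ℝ) ^ 2 * (2 * e + m * (2 * e * C))) := by gcongr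
    _ = _ := by ring

theorem norm_amplitude_le (hC : 0 ≤ C) (hU : ∀ l, Subquadratic C (D.potential l))
    (z₀ : Phase m) {t : ℝ} (ht : 0 ≤ t) :
    ‖D.amplitude H.surfaceAt t z₀‖
      ≤ ‖D.A0 z₀‖ * Real.exp (amplitudeRateBound m C t * t) := by
  have hR : 0 ≤ amplitudeRateBound m C t := by unfold amplitudeRateBound; positivity
  rw [amplitude]
  split_ifs with h
  · obtain ⟨h0, hc, h'⟩ := h.choose_spec
    have := norm_le_exp_of_deriv_right (L := amplitudeRateBound m C t) ht hc h'
      (fun s hs hst => by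
        rw [norm_mul]
        gcongr
        exact norm_amplitudeRate_le hC hU z₀ hs hst.le)
    rwa [h0] at this
  -- Without a solution the amplitude is `A0` by default, so existence need not be settled.
  · exact le_mul_of_one_le_right (norm_nonneg _) (Real.one_le_exp (by positivity))

end Flow

/-! ### The weight -/

theorem energy_mem_Icc (hE : D.bandMin ≤ D.bandMax) (k : Fin N) :
    D.energy k ∈ Icc D.bandMin D.bandMax := by
  have hk : ((k : ℕ) : ℝ) + 1 ≤ N := by exact_mod_cast k.2
  have hN : (0 : ℝ) < N := by exact_mod_cast k.pos
  have hk0 : (0 : ℝ) ≤ ((k : ℕ) : ℝ) := Nat.cast_nonneg _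
  have hs : 0 ≤ D.spacing := div_nonneg (sub_nonneg.2 hE) hN.le
  have hNs : N * D.spacing = D.bandMax - D.bandMin := by
    rw [spacing]; field_simp
  rw [energy]
  constructor
  · nlinarith [mul_nonneg hk0 hs]
  · nlinarith [mul_le_mul_of_nonneg_right hk hs]

/-- Uniform in `N`: the `N` rates out of the molecule add up to at most `N h M₀`, the band width
times `M₀`, and a metal orbital has a single target, with rate at most `M₀`. -/
theorem exitRate_le {M₀ : ℝ} (hE : D.bandMin ≤ D.bandMax)
    (hV : ∀ E ∈ Icc D.bandMin D.bandMax, ∀ x, ‖D.V E x‖ ≤ M₀) (l : Surface N) (q : Space m) :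
    D.exitRate l q ≤ (1 + (D.bandMax - D.bandMin)) * M₀ := by
  have hM : 0 ≤ M₀ := (norm_nonneg _).trans (hV D.bandMin ⟨le_rfl, hE⟩ q)
  have hw : 0 ≤ (D.bandMax - D.bandMin) * M₀ := mul_nonneg (sub_nonneg.2 hE) hM
  rw [exitRate, Fintype.sum_option]
  cases l with
  | none =>
    simp only [hopRate, zero_add]
    have hs : 0 ≤ D.spacing := div_nonneg (sub_nonneg.2 hE) (Nat.cast_nonneg _)
    have hNs : N * D.spacing ≤ D.bandMax - D.bandMin := by
      rw [spacing, mul_comm]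
      rcases (Nat.cast_nonneg (α := ℝ) N).eq_or_lt with h | h
      · rw [← h, mul_zero]; exact sub_nonneg.2 hE
      · rw [div_mul_cancel₀ _ h.ne']
    refine (Finset.sum_le_card_nsmul _ _ (D.spacing * M₀) fun k _ => ?_).trans ?_
    · exact mul_le_mul_of_nonneg_left (hV _ (energy_mem_Icc hE k) q) hs
    · simp only [Finset.card_univ, Fintype.card_fin, nsmul_eq_mul]
      nlinarith [mul_le_mul_of_nonneg_right hNs hM]
  | some k =>
    simp only [hopRate, Finset.sum_const_zero, add_zero]
    nlinarith [hV _ (energy_mem_Icc hE k) q]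

theorem norm_weight_le {M₀ : ℝ} (hE : D.bandMin ≤ D.bandMax)
    (hV : ∀ E ∈ Icc D.bandMin D.bandMax, ∀ x, ‖D.V E x‖ ≤ M₀) (H : History N) {t : ℝ}
    (ht : 0 ≤ t) (z₀ : Phase m) :
    ‖D.weight H t z₀‖ ≤ Real.exp ((1 + (D.bandMax - D.bandMin)) * M₀ * t) := by
  have hrate : ∀ l l' q, 0 ≤ D.hopRate l l' q := fun l l' q => by
    have hs : 0 ≤ D.spacing := div_nonneg (sub_nonneg.2 hE) (Nat.cast_nonneg _)
    unfold hopRate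
    split <;> positivity
  have hint : ∫ s in (0 : ℝ)..t, D.exitRate (H.surfaceAt s) (D.Q H.surfaceAt s z₀)
      ≤ (1 + (D.bandMax - D.bandMin)) * M₀ * t := by
    have := intervalIntegral.norm_integral_le_of_norm_le_const (a := 0) (b := t)
      (f := fun s => D.exitRate (H.surfaceAt s) (D.Q H.surfaceAt s z₀))
      (C := (1 + (D.bandMax - D.bandMin)) * M₀) (fun s _ => by
        rw [exitRate, Real.norm_of_nonneg (Finset.sum_nonneg fun l' _ => hrate _ l' _)]
        exact exitRate_le hE hV _ _)
    rw [sub_zero, abs_of_nonneg ht] at this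
    exact (le_abs_self _).trans this
  rw [weight, norm_mul, Complex.norm_real, Real.norm_of_nonneg (Real.exp_pos _).le, norm_prod]
  refine (mul_le_of_le_one_right (Real.exp_pos _).le ?_).trans (Real.exp_le_exp.2 hint)
  -- A vanishing hop coefficient gives the factor `0 / 0 = 0`, hence modulus at most one rather than
  -- equal to one.
  refine Finset.prod_le_one (fun _ _ => norm_nonneg _) fun j _ => ?_
  rw [norm_div, Complex.norm_real, norm_norm]
  exact div_self_le_one _

end Model

/-! ### The initial amplitude -/

section Gaussian

variable {m : ℕ}

theorem integral_comp_toLp {G : Type*} [NormedAddCommGroup G] [NormedSpace ℝ G]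
    (f : Space m → G) : ∫ v : Fin m → ℝ, f (WithLp.toLp 2 v) = ∫ y, f y :=
  (PiLp.volume_preserving_toLp (Fin m)).integral_comp
    (MeasurableEquiv.toLp 2 (Fin m → ℝ)).measurableEmbedding f

theorem integral_exp_neg_sum_mul_sq (α : Fin m → ℝ) (y₀ : Space m) :
    ∫ y : Space m, Real.exp (-∑ j, α j * (y j - y₀ j) ^ 2) = ∏ j, √(Real.pi / α j) := by
  have h := integral_sub_right_eq_self
    (fun y : Space m => Real.exp (-∑ j, α j * y j ^ 2)) y₀ (μ := volume)
  simp only [PiLp.sub_apply] at h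
  rw [h, ← integral_comp_toLp]
  simp_rw [← Finset.sum_neg_distrib, Real.exp_sum, ← neg_mul]
  rw [integral_fintype_prod_volume_eq_prod (fun j (x : ℝ) => Real.exp (-α j * x ^ 2))]
  exact Finset.prod_congr rfl fun j _ => integral_gaussian _

end Gaussian

namespace Model

variable {m N : ℕ} {D : Model m N}

/-- Sorting the exponent by powers of `y` puts it in the form of the complex Gaussian integral. -/
theorem integrand_A0_eq (hε : D.eps ≠ 0) (z : Phase m) (y : Space m) :
    Complex.exp (Complex.I / D.eps * (inner ℝ D.pIn (y - D.qIn) : ℝ))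
      * Complex.exp ((-∑ j, D.a j / (2 * D.eps) * (y j - D.qIn j) ^ 2 : ℝ) : ℂ)
      * Complex.exp (Complex.I / D.eps *
        (-((inner ℝ z.2 (y - z.1) : ℝ) : ℂ) + Complex.I / 2 * ((‖y - z.1‖ ^ 2 : ℝ) : ℂ)))
    = Complex.exp (∑ j, (-(((D.a j * D.qIn j ^ 2 + z.1 j ^ 2) / (2 * D.eps) : ℝ) : ℂ)
          + ((z.2 j * z.1 j - D.pIn j * D.qIn j) / D.eps : ℝ) * Complex.I))
      * Complex.exp (-∑ j, (((1 + D.a j) / (2 * D.eps) : ℝ) : ℂ) * (y j : ℂ) ^ 2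
        + ∑ j, ((((D.a j * D.qIn j + z.1 j) / D.eps : ℝ) : ℂ)
          + ((D.pIn j - z.2 j) / D.eps : ℝ) * Complex.I) * y j) := by
  rw [← Complex.exp_add, ← Complex.exp_add, ← Complex.exp_add]
  congr 1
  rw [EuclideanSpace.real_norm_sq_eq, PiLp.inner_apply, PiLp.inner_apply]
  have hε' : (D.eps : ℂ) ≠ 0 := by exact_mod_cast hε
  push_cast
  simp only [mul_add, Finset.mul_sum, ← Finset.sum_neg_distrib, ← Finset.sum_add_distrib]
  refine Finset.sum_congr rfl fun j _ => ?_
  simp only [PiLp.sub_apply, RCLike.inner_apply, conj_trivial]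
  push_cast
  field_simp
  ring_nf
  simp only [Complex.I_sq]
  ring

theorem norm_A0 (hε : 0 < D.eps) (ha : ∀ j, 0 < D.a j) (z : Phase m) :
    ‖D.A0 z‖ = ((2 : ℝ) ^ ((m : ℝ) / 2) *
        ((∏ j, D.a j) ^ (1 / 4 : ℝ) * (Real.pi * D.eps) ^ (-(m : ℝ) / 4)) *
        ∏ j, √(Real.pi / ((1 + D.a j) / (2 * D.eps))))
      * (Real.exp (-∑ j, D.a j / (2 * D.eps * (1 + D.a j)) * (z.1 j - D.qIn j) ^ 2)
        * Real.exp (-∑ j, 1 / (2 * D.eps * (1 + D.a j)) * (z.2 j - D.pIn j) ^ 2)) := by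
  have hb : ∀ j, 0 < (1 + D.a j) / (2 * D.eps) := fun j => by
    have := ha j; positivity
  set c : Fin m → ℂ := fun j => (((D.a j * D.qIn j + z.1 j) / D.eps : ℝ) : ℂ)
          + ((D.pIn j - z.2 j) / D.eps : ℝ) * Complex.I with hc
  have hgauss := GaussianFourier.integral_cexp_neg_sum_mul_add
    (b := fun j => (((1 + D.a j) / (2 * D.eps) : ℝ) : ℂ))
    (fun j => by rw [Complex.ofReal_re]; exact hb j) c
  have hprodnn : 0 ≤ ∏ j, D.a j := Finset.prod_nonneg fun j _ => (ha j).le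
  have hA : D.A0 z = (((2 : ℝ) ^ ((m : ℝ) / 2) : ℝ) : ℂ) * ∫ v : Fin m → ℝ,
      (((∏ j, D.a j) ^ (1 / 4 : ℝ) * (Real.pi * D.eps) ^ (-(m : ℝ) / 4) : ℝ) : ℂ) *
        (Complex.exp (∑ j, (-(((D.a j * D.qIn j ^ 2 + z.1 j ^ 2) / (2 * D.eps) : ℝ) : ℂ)
          + ((z.2 j * z.1 j - D.pIn j * D.qIn j) / D.eps : ℝ) * Complex.I)) *
        Complex.exp (-∑ j, (((1 + D.a j) / (2 * D.eps) : ℝ) : ℂ) * (v j : ℂ) ^ 2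
          + ∑ j, c j * v j)) := by
    rw [A0, ← integral_comp_toLp]
    congr 1
    refine integral_congr_ae (Eventually.of_forall fun v => ?_)
    refine Eq.trans ?_ (congrArg
      ((((∏ j, D.a j) ^ (1 / 4 : ℝ) * (Real.pi * D.eps) ^ (-(m : ℝ) / 4) : ℝ) : ℂ) * ·)
      (integrand_A0_eq hε.ne' z (WithLp.toLp 2 v)))
    simp only [uIn]
    ring
  rw [hA, integral_const_mul, integral_const_mul, hgauss]
  simp only [norm_mul, norm_prod, Complex.norm_real, Complex.norm_exp]
  rw [Real.norm_of_nonneg (by positivity : (0 : ℝ) ≤ 2 ^ ((m : ℝ) / 2)),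
    Real.norm_of_nonneg (by positivity : (0 : ℝ) ≤ (∏ j, D.a j) ^ (1 / 4 : ℝ)),
    Real.norm_of_nonneg (by positivity : (0 : ℝ) ≤ (Real.pi * D.eps) ^ (-(m : ℝ) / 4))]
  have hcpow : ∀ j, ‖((Real.pi : ℂ) / (((1 + D.a j) / (2 * D.eps) : ℝ) : ℂ)) ^ (1 / 2 : ℂ)‖
      = √(Real.pi / ((1 + D.a j) / (2 * D.eps))) := fun j => by
    rw [← Complex.ofReal_div, Complex.norm_cpow_eq_rpow_re_of_pos (div_pos Real.pi_pos (hb j)),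
      Real.sqrt_eq_rpow]
    norm_num
  have hre : ∀ j, (c j ^ 2 / (4 * (((1 + D.a j) / (2 * D.eps) : ℝ) : ℂ))).re
      = ((D.a j * D.qIn j + z.1 j) ^ 2 - (D.pIn j - z.2 j) ^ 2)
        / (2 * D.eps * (1 + D.a j)) := fun j => by
    have h1 : (4 * (((1 + D.a j) / (2 * D.eps) : ℝ) : ℂ))
        = ((2 * (1 + D.a j) / D.eps : ℝ) : ℂ) := by
      push_cast; ring
    have h2 : (c j ^ 2).re = ((D.a j * D.qIn j + z.1 j) / D.eps) ^ 2
        - ((D.pIn j - z.2 j) / D.eps) ^ 2 := by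
      simp only [hc, sq, Complex.mul_re, Complex.add_re, Complex.add_im, Complex.ofReal_re,
        Complex.ofReal_im, Complex.mul_im, Complex.I_re, Complex.I_im]
      ring
    have := ha j
    rw [h1, Complex.div_ofReal_re, h2]
    field_simp
  simp only [hcpow, hre]
  rw [Finset.prod_mul_distrib, ← Real.exp_sum]
  -- Completing the square: `(1 + a)(a q̃² + q²) - (a q̃ + q)² = a (q - q̃)²` in each coordinate.
  have hexp : Real.exp (∑ j, (-(((D.a j * D.qIn j ^ 2 + z.1 j ^ 2) / (2 * D.eps) : ℝ) : ℂ)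
          + ((z.2 j * z.1 j - D.pIn j * D.qIn j) / D.eps : ℝ) * Complex.I)).re
      * Real.exp (∑ j, ((D.a j * D.qIn j + z.1 j) ^ 2 - (D.pIn j - z.2 j) ^ 2)
        / (2 * D.eps * (1 + D.a j)))
      = Real.exp (-∑ j, D.a j / (2 * D.eps * (1 + D.a j)) * (z.1 j - D.qIn j) ^ 2)
        * Real.exp (-∑ j, 1 / (2 * D.eps * (1 + D.a j)) * (z.2 j - D.pIn j) ^ 2) := by
    rw [← Real.exp_add, ← Real.exp_add, Complex.re_sum]
    congr 1
    rw [← Finset.sum_neg_distrib, ← Finset.sum_neg_distrib, ← Finset.sum_add_distrib,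
      ← Finset.sum_add_distrib]
    refine Finset.sum_congr rfl fun j _ => ?_
    have := ha j
    simp only [Complex.add_re, Complex.neg_re, Complex.ofReal_re, Complex.mul_re, Complex.I_re,
      Complex.I_im, Complex.ofReal_im]
    field_simp
    ring
  rw [← hexp]
  ring

theorem integral_norm_A0 (hε : 0 < D.eps) (ha : ∀ j, 0 < D.a j) :
    ∫ z, ‖D.A0 z‖ = ((2 : ℝ) ^ ((m : ℝ) / 2) *
        ((∏ j, D.a j) ^ (1 / 4 : ℝ) * (Real.pi * D.eps) ^ (-(m : ℝ) / 4)) *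
        ∏ j, √(Real.pi / ((1 + D.a j) / (2 * D.eps))))
      * ((∏ j, √(Real.pi / (D.a j / (2 * D.eps * (1 + D.a j)))))
        * ∏ j, √(Real.pi / (1 / (2 * D.eps * (1 + D.a j))))) := by
  simp_rw [norm_A0 hε ha]
  rw [integral_const_mul]
  congr 1
  have h := integral_prod_mul (μ := volume) (ν := volume)
    (fun q : Space m =>
      Real.exp (-∑ j, D.a j / (2 * D.eps * (1 + D.a j)) * (q j - D.qIn j) ^ 2))
    (fun p : Space m => Real.exp (-∑ j, 1 / (2 * D.eps * (1 + D.a j)) * (p j - D.pIn j) ^ 2))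
  rw [integral_exp_neg_sum_mul_sq (fun j => D.a j / (2 * D.eps * (1 + D.a j))) D.qIn,
    integral_exp_neg_sum_mul_sq (fun j => 1 / (2 * D.eps * (1 + D.a j))) D.pIn] at h
  exact h

/-- The second factor is the squared prefactor of the packet times the squared norm of its Gaussian
profile. In each coordinate all powers of `π ε` cancel and `2 (1 + a) / √a` is left. -/
theorem integral_norm_A0_sq (hε : 0 < D.eps) (ha : ∀ j, 0 < D.a j) :
    (∫ z, ‖D.A0 z‖) ^ 2 * ((1 / (2 * Real.pi * D.eps) ^ (3 * (m : ℝ) / 2)) ^ 2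
      * (Real.pi * D.eps) ^ ((m : ℝ) / 2)) = 2 ^ m * ∏ j, (1 + D.a j) / √(D.a j) := by
  have hprodnn : 0 ≤ ∏ j, D.a j := Finset.prod_nonneg fun j _ => (ha j).le
  have hπε : 0 < Real.pi * D.eps := by positivity
  have h2πε : 0 < 2 * Real.pi * D.eps := by positivity
  have e1 : ((2 : ℝ) ^ ((m : ℝ) / 2)) ^ 2 = 2 ^ m := by
    rw [← Real.rpow_natCast, ← Real.rpow_mul (by norm_num), ← Real.rpow_natCast]
    congr 1; push_cast; ring
  have e2 : ((∏ j, D.a j) ^ (1 / 4 : ℝ)) ^ 2 = ∏ j, √(D.a j) := by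
    rw [← Real.rpow_natCast, ← Real.rpow_mul hprodnn, ← Real.sqrt_prod _ fun j _ => (ha j).le,
      Real.sqrt_eq_rpow]
    norm_num
  have e3 : ((Real.pi * D.eps) ^ (-(m : ℝ) / 4)) ^ 2 * (Real.pi * D.eps) ^ ((m : ℝ) / 2) = 1 := by
    rw [← Real.rpow_natCast, ← Real.rpow_mul hπε.le, ← Real.rpow_add hπε]
    convert Real.rpow_zero _ using 2
    push_cast; ring
  have e4 : (1 / (2 * Real.pi * D.eps) ^ (3 * (m : ℝ) / 2)) ^ 2
      = ∏ _j : Fin m, 1 / (2 * Real.pi * D.eps) ^ 3 := by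
    rw [Finset.prod_const, Finset.card_univ, Fintype.card_fin, div_pow, div_pow, one_pow, one_pow,
      ← pow_mul, ← Real.rpow_natCast, ← Real.rpow_mul h2πε.le, ← Real.rpow_natCast]
    congr 2; push_cast; ring
  have e5 : ∀ b : Fin m → ℝ, (∀ j, 0 ≤ b j) → (∏ j, √(b j)) ^ 2 = ∏ j, b j := fun b hb => by
    rw [← Finset.prod_pow]
    exact Finset.prod_congr rfl fun j _ => Real.sq_sqrt (hb j)
  have e6 : ∀ T v e p₁ p₂ p₃ p₄ w : ℝ, (T * (v * e) * p₁ * (p₂ * p₃)) ^ 2 * (p₄ * w)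
      = T ^ 2 * (e ^ 2 * w) * ((v ^ 2 * p₁ ^ 2) * (p₂ ^ 2 * p₃ ^ 2) * p₄) := by
    intros; ring
  rw [integral_norm_A0 hε ha, e4, e6, e1, e2, e3, mul_one, e5 _ fun j => ?_, e5 _ fun j => ?_,
    e5 _ fun j => ?_, ← Finset.prod_mul_distrib, ← Finset.prod_mul_distrib,
    ← Finset.prod_mul_distrib, ← Finset.prod_mul_distrib]
  · congr 1
    refine Finset.prod_congr rfl fun j _ => ?_
    have h := ha j
    have hs : 0 < √(D.a j) := Real.sqrt_pos.2 h
    have hsq := Real.sq_sqrt h.le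
    field_simp
    rw [hsq]
  all_goals
    have := ha j
    positivity

/-! ### The wave packets -/

theorem norm_exp_phase (hε : 0 < D.eps) (ℓ : ℝ → Surface N) (t : ℝ) (z₀ : Phase m)
    (x : Space m) :
    ‖Complex.exp (Complex.I / D.eps * D.phase ℓ t z₀ x)‖ ^ 2
      = Real.exp (-(1 / D.eps) * ‖x - D.Q ℓ t z₀‖ ^ 2) := by
  rw [Complex.norm_exp, ← Real.exp_nat_mul]
  congr 1
  have h : Complex.I / D.eps * D.phase ℓ t z₀ x
      = ((-(1 / (2 * D.eps)) * ‖x - D.Q ℓ t z₀‖ ^ 2 : ℝ) : ℂ)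
        + ((1 / D.eps * (D.action ℓ t z₀ + inner ℝ (D.P ℓ t z₀) (x - D.Q ℓ t z₀)) : ℝ) : ℂ)
          * Complex.I := by
    have hε' : (D.eps : ℂ) ≠ 0 := by exact_mod_cast hε.ne'
    rw [phase]
    push_cast
    field_simp
    ring_nf
    simp only [Complex.I_sq]
    ring
  rw [h, Complex.add_re, Complex.ofReal_re, Complex.re_ofReal_mul, Complex.I_re, mul_zero,
    add_zero]
  push_cast
  ring

theorem norm_amplitude_mul_weight_div_samplingDensity_le (H : History N) {t G : ℝ}
    (z₀ : Phase m) (hG : 0 ≤ G)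
    (hA : ‖D.amplitude H.surfaceAt t z₀‖ * ‖D.weight H t z₀‖ ≤ ‖D.A0 z₀‖ * G) :
    ‖((1 / D.samplingDensity z₀ : ℝ) : ℂ)‖ *
      (‖D.amplitude H.surfaceAt t z₀‖ * ‖D.weight H t z₀‖) ≤ (∫ w, ‖D.A0 w‖) * G := by
  have hJ0 : 0 ≤ ∫ w, ‖D.A0 w‖ := integral_nonneg fun w => norm_nonneg _
  have hnorm : ‖((1 / D.samplingDensity z₀ : ℝ) : ℂ)‖ = (∫ w, ‖D.A0 w‖) / ‖D.A0 z₀‖ := by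
    rw [Complex.norm_real, samplingDensity, one_div_div]
    exact Real.norm_of_nonneg (div_nonneg hJ0 (norm_nonneg _))
  rw [hnorm]
  generalize (∫ w, ‖D.A0 w‖) = J at *
  generalize ‖D.amplitude H.surfaceAt t z₀‖ * ‖D.weight H t z₀‖ = b at *
  have hn : 0 ≤ ‖D.A0 z₀‖ := norm_nonneg _
  generalize ‖D.A0 z₀‖ = n at *
  rcases hn.eq_or_lt with h | h
  -- If `A₀(z₀) = 0`, division by zero makes the sampling factor `0`.
  · rw [← h, div_zero, zero_mul]
    exact mul_nonneg hJ0 hG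
  · calc J / n * b ≤ J / n * (n * G) := by gcongr
      _ = J * G := by field_simp

theorem packetNormSq_le (hε : 0 < D.eps) (ha : ∀ j, 0 < D.a j) (H : History N) {t G : ℝ}
    (z₀ : Phase m) (hG : 0 ≤ G)
    (hA : ‖D.amplitude H.surfaceAt t z₀‖ * ‖D.weight H t z₀‖ ≤ ‖D.A0 z₀‖ * G) :
    D.packetNormSq H t z₀
      ≤ ENNReal.ofReal (G ^ 2 * (2 ^ m * ∏ j, (1 + D.a j) / √(D.a j))) := by
  have hfac := norm_amplitude_mul_weight_div_samplingDensity_le H z₀ hG hA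
  obtain ⟨J, hJ⟩ : ∃ J, J = ∫ w, ‖D.A0 w‖ := ⟨_, rfl⟩
  obtain ⟨κ, hκ⟩ : ∃ κ : ℝ, κ = 1 / (2 * Real.pi * D.eps) ^ (3 * (m : ℝ) / 2) := ⟨_, rfl⟩
  have hκ0 : 0 ≤ κ := by rw [hκ]; positivity
  rw [← hJ] at hfac
  have hW : ∀ x, ‖D.wavePacket H t z₀ x‖ ^ 2
      ≤ (κ * (J * G)) ^ 2 * Real.exp (-(1 / D.eps) * ‖x - D.Q H.surfaceAt t z₀‖ ^ 2) :=
    fun x => by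
      rw [← norm_exp_phase hε, ← mul_pow, wavePacket]
      simp only [norm_mul]
      rw [← hκ, Complex.norm_real κ, Real.norm_of_nonneg hκ0]
      set e := ‖Complex.exp (Complex.I / D.eps * D.phase H.surfaceAt t z₀ x)‖
      have he : 0 ≤ e := norm_nonneg _
      refine pow_le_pow_left₀ (by positivity) ?_ 2
      calc _ = κ * (‖((1 / D.samplingDensity z₀ : ℝ) : ℂ)‖ *
            (‖D.amplitude H.surfaceAt t z₀‖ * ‖D.weight H t z₀‖)) * e := by ring
        _ ≤ κ * (J * G) * e := by gcongr
  have hgauss : ∫ x : Space m, Real.exp (-(1 / D.eps) * ‖x - D.Q H.surfaceAt t z₀‖ ^ 2)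
      = (Real.pi * D.eps) ^ ((m : ℝ) / 2) := by
    rw [integral_sub_right_eq_self
      (fun x : Space m => Real.exp (-(1 / D.eps) * ‖x‖ ^ 2)),
      GaussianFourier.integral_rexp_neg_mul_sq_norm (by positivity)]
    simp
  have hint : Integrable fun x : Space m =>
      Real.exp (-(1 / D.eps) * ‖x - D.Q H.surfaceAt t z₀‖ ^ 2) := by
    -- A non-integrable function has Bochner integral `0`, contradicting the positive value just
    -- computed.
    by_contra h
    rw [integral_undef h] at hgauss
    have : 0 < (Real.pi * D.eps) ^ ((m : ℝ) / 2) := by positivity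
    exact this.ne hgauss
  calc D.packetNormSq H t z₀
      ≤ ∫⁻ x : Space m, ENNReal.ofReal ((κ * (J * G)) ^ 2 *
          Real.exp (-(1 / D.eps) * ‖x - D.Q H.surfaceAt t z₀‖ ^ 2)) := by
        refine lintegral_mono fun x => ?_
        rw [← ofReal_norm, ← ENNReal.ofReal_pow (norm_nonneg _)]
        exact ENNReal.ofReal_le_ofReal (hW x)
    _ = ENNReal.ofReal ((κ * (J * G)) ^ 2 * (Real.pi * D.eps) ^ ((m : ℝ) / 2)) := by
        rw [← hgauss, ← integral_const_mul, ofReal_integral_eq_lintegral_ofReal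
          (hint.const_mul _) (Eventually.of_forall fun x => by positivity)]
    _ = _ := by
        rw [← integral_norm_A0_sq hε ha, ← hJ, ← hκ]
        congr 1
        ring

/-! ### The law of the process -/

/-- Only total mass at most one is needed, so the degenerate cases, where the density is `0` by
convention, do no harm. -/
theorem lintegral_samplingDensity_le_one (D : Model m N) :
    ∫⁻ z, ENNReal.ofReal (D.samplingDensity z) ≤ 1 := by
  by_cases h : Integrable fun z => ‖D.A0 z‖
  · unfold samplingDensity
    rw [← ofReal_integral_eq_lintegral_ofReal (h.div_const _) (Eventually.of_forall fun z =>
      div_nonneg (norm_nonneg _) (integral_nonneg fun w => norm_nonneg _)), integral_div,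
      ENNReal.ofReal_le_one]
    exact div_self_le_one _
  · simp [samplingDensity, integral_undef h]

theorem law_univ_le_one (D : Model m N) : D.law univ ≤ 1 := by
  have := isProbabilityMeasure_expMeasure zero_lt_one
  rw [law, ← univ_prod_univ, Measure.prod_prod, measure_univ (μ := Measure.infinitePi _), mul_one,
    withDensity_apply _ .univ,
    Measure.restrict_univ]
  exact D.lintegral_samplingDensity_le_one

theorem expectedNormSq_le {C M₀ : ℝ} (hC : 0 ≤ C) (hε : 0 < D.eps) (ha : ∀ j, 0 < D.a j)
    (hE : D.bandMin ≤ D.bandMax) (h0 : Subquadratic C D.U0) (h1 : Subquadratic C D.U1)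
    (hV : ∀ E ∈ Icc D.bandMin D.bandMax, ∀ x, ‖D.V E x‖ ≤ M₀) {t : ℝ} (ht : 0 ≤ t) :
    D.expectedNormSq t ≤ ENNReal.ofReal ((Real.exp (amplitudeRateBound m C t * t) *
      Real.exp ((1 + (D.bandMax - D.bandMin)) * M₀ * t)) ^ 2 *
        (2 ^ m * ∏ j, (1 + D.a j) / √(D.a j))) := by
  rw [expectedNormSq]
  have hbound : ∀ (H : History N) (z₀ : Phase m), ‖D.amplitude H.surfaceAt t z₀‖
      * ‖D.weight H t z₀‖ ≤ ‖D.A0 z₀‖ * (Real.exp (amplitudeRateBound m C t * t) *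
        Real.exp ((1 + (D.bandMax - D.bandMin)) * M₀ * t)) := fun H z₀ => by
    rw [← mul_assoc]
    exact mul_le_mul (norm_amplitude_le hC (subquadratic_potential h0 h1) z₀ ht)
      (norm_weight_le hE hV H ht z₀) (norm_nonneg _)
      (mul_nonneg (norm_nonneg _) (Real.exp_pos _).le)
  calc ∫⁻ ξ, D.packetNormSq (D.history ξ.1 ξ.2 t) t ξ.1 ∂D.law
      ≤ ∫⁻ _ξ, ENNReal.ofReal ((Real.exp (amplitudeRateBound m C t * t) *
          Real.exp ((1 + (D.bandMax - D.bandMin)) * M₀ * t)) ^ 2 *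
            (2 ^ m * ∏ j, (1 + D.a j) / √(D.a j))) ∂D.law :=
        lintegral_mono fun ξ => packetNormSq_le hε ha _ _
          (mul_pos (Real.exp_pos _) (Real.exp_pos _)).le (hbound _ _)
    _ = _ * D.law univ := lintegral_const _
    _ ≤ _ := mul_le_of_le_one_right' D.law_univ_le_one

end Model

end

end FrozenGaussian

/-! ### Choice of the constant and conclusion. -/

theorem theorem4p2 (m : ℕ) (C_E M₀ E_a E_b : ℝ) (hE : E_a < E_b) :
    ∃ K : ℝ → ℝ, ∀ (t : ℝ), 0 ≤ t →
      ∀ (ε : ℝ), 0 < ε → ∀ (N : ℕ), 1 ≤ N →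
      ∀ (U₀ U₁ : EuclideanSpace ℝ (Fin m) → ℝ) (V : ℝ → EuclideanSpace ℝ (Fin m) → ℂ)
        (a : Fin m → ℝ) (qIn pIn : EuclideanSpace ℝ (Fin m)),
        FrozenGaussian.Subquadratic C_E U₀ → FrozenGaussian.Subquadratic C_E U₁ →
        (∀ E ∈ Set.Icc E_a E_b, Measurable (V E)) →
        (∀ E ∈ Set.Icc E_a E_b, ∀ x, ‖V E x‖ ≤ M₀) →
        (∀ j, 0 < a j) →
        ({ eps := ε, bandMin := E_a, bandMax := E_b, U0 := U₀, U1 := U₁, V := V,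
           a := a, qIn := qIn, pIn := pIn } : FrozenGaussian.Model m N).expectedNormSq t
          ≤ ENNReal.ofReal (K t ^ 2 * ∏ j, (1 + a j) / √(a j)) := by
  -- The factor `√(2 ^ m)` absorbs the `2 ^ m` of `integral_norm_A0_sq`. The absolute value is there
  -- because for `m = 0` nothing forces `C_E` to be nonnegative.
  refine ⟨fun t => Real.exp (FrozenGaussian.Model.amplitudeRateBound m |C_E| t * t) *
    Real.exp ((1 + (E_b - E_a)) * M₀ * t) * √(2 ^ m), ?_⟩
  intro t ht ε hε N _ U₀ U₁ V a qIn pIn h0 h1 _ hV ha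
  have habs : ∀ U : FrozenGaussian.Space m → ℝ,
      FrozenGaussian.Subquadratic C_E U → FrozenGaussian.Subquadratic |C_E| U :=
    fun U hU => ⟨hU.1, fun x i j => (hU.2 x i j).trans (le_abs_self _)⟩
  rw [mul_pow, Real.sq_sqrt (by positivity), mul_assoc]
  exact FrozenGaussian.Model.expectedNormSq_le
    (D := { eps := ε, bandMin := E_a, bandMax := E_b, U0 := U₀, U1 := U₁, V := V,
            a := a, qIn := qIn, pIn := pIn })
    (abs_nonneg _) hε ha hE.le (habs _ h0) (habs _ h1) hV ht
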